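/- **Conventions.** All $C^*$-algebras are unital (the zero algebra is allowed) and $*$-homomorphisms are unital. For a sequence $(a_n)$ of self-adjoint elements, $a_n \nearrow a$ means that $(a_n)$ is increasing with supremum $a$. A *$\sigma C^*$-algebra* is a $C^*$-algebra in which every norm-bounded increasing sequence of self-adjoint elements has a supremum; a positive map $\phi$ is *$\sigma$-normal* if $a_n \nearrow a$ implies $\phi(a_n) \nearrow \phi(a)$; a *$\sigma$-cpu map* is a $\sigma$-normal completely positive unital linear map; a *$\sigma$-homomorphism* is a $\sigma$-normal $*$-homomorphism. Let $\mathsf{c}\sigma\mathsf{C}^*_{\sigma\mathrm{cpu}}$ be the category of commutative $\sigma C^*$-algebras and $\sigma$-cpu maps, and consider its following full subcategories. - $\mathsf{cPureRep}\sigma\mathsf{C}^*_{\sigma\mathrm{cpu}}$: the purely $\sigma$-representable algebras $\mathcal A$, i.e. every $x \ge 0$ in $\mathcal A$ such that $\phi(x) = 0$ for all pure $\sigma$-states $\phi$ is zero. Here a pure $\sigma$-state is a $\sigma$-normal state that is an extreme point of the convex set of all states. - $\mathsf{cPedBaireC}^*_{\sigma\mathrm{cpu}}$: the commutative algebras $*$-isomorphic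 to the Pedersen–Baire envelope $\mathcal A^\infty$ of some $C^*$-algebra $\mathcal A$, and $\mathsf{cPedBaireSepC}^*_{\sigma\mathrm{cpu}}$: the same with $\mathcal A$ separable. Here $\mathcal A^\infty$ is the $\sigma$-closure of $\mathcal A$ in $\mathcal B(\mathcal H_u)$, where $\mathcal H_u$ is the space of the universal representation (equivalently, in $\mathcal A^{**}$), that is, the smallest linear subspace that contains $\mathcal A$, is closed under $*$, and contains $a$ whenever it contains all $a_n$ and $a_n \nearrow a$ in $\mathcal B(\mathcal H_u)$. Let $\mathsf{Stoch}$ be the category of measurable spaces and Markov kernels. Let $\mathsf{BaireStoch}$ and $\mathsf{StBorelStoch}$ be its full subcategories on the Baire measurable spaces (those whose $\sigma$-algebra is generated by the continuous real functions for some compact Hausdorff topology) and on the standard Borel spaces. For a measurable space $X$ let $\mathscr L^\infty(X)$ be the algebra of bounded measurable functions $X \to \mathbb C$, with pointwise operations and order and the supremum norm, and for a Markov kernel $\mu$ from $X$ to $Y$ let $\mathscr L^\infty(\mu) \colon \mathscr L^\infty(Y) \to \mathscr L^\infty(X)$ be the Koopman operator $$\mathscr L^\infty(\mu)(f)(x)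 = \int_Y f(y)\, d\mu(y \mid x).$$ For a commutative $\sigma C^*$-algebra $\mathcal A$ let $\mathrm{Spec}_\sigma(\mathcal A)$ be the set of $\sigma$-homomorphisms $\mathcal A \to \mathbb C$ with the smallest $\sigma$-algebra making all evaluations $\chi \mapsto \chi(a)$, $a \in \mathcal A$, measurable. **Proposition.** $\mathscr L^\infty$ is a fully faithful contravariant functor from $\mathsf{Stoch}$ to $\mathsf{c}\sigma\mathsf{C}^*_{\sigma\mathrm{cpu}}$, and all its values are purely $\sigma$-representable. On $\mathsf{cPureRep}\sigma\mathsf{C}^*_{\sigma\mathrm{cpu}}$, the assignment $\mathrm{Spec}_\sigma$ becomes a contravariant functor to $\mathsf{Stoch}$ which sends a $\sigma$-cpu map $\phi \colon \mathcal A \to \mathcal B$ to a Markov kernel $\kappa_\phi$ from $\mathrm{Spec}_\sigma(\mathcal B)$ to $\mathrm{Spec}_\sigma(\mathcal A)$ with $$\int \chi(a)\, d\kappa_\phi(\chi \mid \psi) = \psi(\phi(a)) \qquad (a \in \mathcal A,\ \psi \in \mathrm{Spec}_\sigma(\mathcal B)).$$ The functors $\mathscr L^\infty$ and $\mathrm{Spec}_\sigma$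 form a dual equivalence $$\mathsf{Stoch} \cong^{\mathrm{op}} \mathsf{cPureRep}\sigma\mathsf{C}^*_{\sigma\mathrm{cpu}}.$$ Moreover, $\mathsf{cPedBaireC}^*_{\sigma\mathrm{cpu}}$ and $\mathsf{cPedBaireSepC}^*_{\sigma\mathrm{cpu}}$ are contained in $\mathsf{cPureRep}\sigma\mathsf{C}^*_{\sigma\mathrm{cpu}}$, and the same two functors restrict to dual equivalences $$\mathsf{BaireStoch} \cong^{\mathrm{op}} \mathsf{cPedBaireC}^*_{\sigma\mathrm{cpu}}, \qquad \mathsf{StBorelStoch} \cong^{\mathrm{op}} \mathsf{cPedBaireSepC}^*_{\sigma\mathrm{cpu}}.$$ -/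

import Mathlib

open CategoryTheory MeasureTheory ProbabilityTheory
open scoped ComplexOrder CStarAlgebra ENNReal

universe u v

noncomputable section

/-- The bounded measurable functions `X → ℂ`, as a star subalgebra of the C⋆-algebra of all bounded
functions with the supremum norm. -/
def linfSubalgebra (X : Type u) [MeasurableSpace X] :
    StarSubalgebra ℂ (lp (fun _ : X => ℂ) ∞) where
  carrier := {f | Measurable (f : X → ℂ)}
  mul_mem' {f g} hf hg := by
    change Measurable (⇑(f * g))
    rw [lp.infty_coeFn_mul]; exact Measurable.mul hf hg
  add_mem' {f g} hf hg := by
    change Measurable (⇑(f + g))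
    rw [lp.coeFn_add]; exact Measurable.add hf hg
  algebraMap_mem' r := by
    change Measurable (fun _ : X => r)
    exact measurable_const
  star_mem' {f} hf := by
    change Measurable (⇑(star f))
    rw [lp.coeFn_star]
    exact (continuous_star.measurable : Measurable (star : ℂ → ℂ)).comp hf

instance isClosed_linfSubalgebra (X : Type u) [MeasurableSpace X] :
    IsClosed (linfSubalgebra X : Set (lp (fun _ : X => ℂ) ∞)) := by
  refine isSeqClosed_iff_isClosed.mp fun f g hf hg => ?_
  refine measurable_of_tendsto_metrizable hf (tendsto_pi_nhds.mpr fun x => ?_)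
  exact ((lp.lipschitzWith_one_eval (E := fun _ : X => ℂ) ∞ x).continuous.tendsto g).comp hg

/-- The commutative C⋆-algebra of bounded measurable functions `X → ℂ` (genuine functions, not
classes modulo null sets), with pointwise operations, pointwise order and supremum norm. -/
def Linf (X : Type u) [MeasurableSpace X] : Type u := linfSubalgebra X

namespace Linf

variable {X Y Z : Type u} [MeasurableSpace X] [MeasurableSpace Y] [MeasurableSpace Z]

instance : CommCStarAlgebra (Linf X) :=
  inferInstanceAs (CommCStarAlgebra (linfSubalgebra X))

instance : FunLike (Linf X) X ℂ where
  coe f := (f.1 : X → ℂ)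
  coe_injective _ _ h := Subtype.ext (lp.ext h)

@[ext] theorem ext {f g : Linf X} (h : ∀ x, f x = g x) : f = g := DFunLike.ext _ _ h

theorem measurable (f : Linf X) : Measurable f := f.2

theorem norm_apply_le (f : Linf X) (x : X) : ‖f x‖ ≤ ‖f‖ :=
  lp.norm_apply_le_norm (E := fun _ : X => ℂ) ENNReal.top_ne_zero f.1 x

theorem norm_le {f : Linf X} {C : ℝ} (hC : 0 ≤ C) (h : ∀ x, ‖f x‖ ≤ C) : ‖f‖ ≤ C :=
  lp.norm_le_of_forall_le (E := fun _ : X => ℂ) hC h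

/-- A bounded measurable function as an element of `Linf X`. -/
def mk (f : X → ℂ) (hf : Measurable f) (C : ℝ) (hC : ∀ x, ‖f x‖ ≤ C) : Linf X :=
  ⟨⟨f, memℓp_infty ⟨C, by rintro _ ⟨x, rfl⟩; exact hC x⟩⟩, hf⟩

@[simp] theorem mk_apply (f : X → ℂ) (hf : Measurable f) (C : ℝ) (hC : ∀ x, ‖f x‖ ≤ C) (x : X) :
    mk f hf C hC x = f x := rfl
@[simp] theorem add_apply (f g : Linf X) (x : X) : (f + g) x = f x + g x := rfl
@[simp] theorem sub_apply (f g : Linf X) (x : X) : (f - g) x = f x - g x := rfl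
@[simp] theorem mul_apply (f g : Linf X) (x : X) : (f * g) x = f x * g x := rfl
@[simp] theorem star_apply (f : Linf X) (x : X) : (star f) x = star (f x) := rfl
@[simp] theorem smul_apply (c : ℂ) (f : Linf X) (x : X) : (c • f) x = c * f x := rfl
@[simp] theorem one_apply (x : X) : (1 : Linf X) x = 1 := rfl
@[simp] theorem zero_apply (x : X) : (0 : Linf X) x = 0 := rfl

instance : PartialOrder (Linf X) where
  le f g := ∀ x, f x ≤ g x
  le_refl f x := le_refl _
  le_trans f g h h₁ h₂ x := (h₁ x).trans (h₂ x)
  le_antisymm f g h₁ h₂ := ext fun x => le_antisymm (h₁ x) (h₂ x)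

theorem le_def {f g : Linf X} : f ≤ g ↔ ∀ x, f x ≤ g x := Iff.rfl

instance : StarOrderedRing (Linf X) := by
  refine StarOrderedRing.of_le_iff fun f g => ⟨fun h => ?_, ?_⟩
  · refine ⟨mk (fun x => (Real.sqrt (g x - f x).re : ℂ)) ?_ (Real.sqrt ‖g - f‖) ?_, ?_⟩
    · have h1 := g.measurable
      have h2 := f.measurable
      fun_prop
    · intro x
      rw [Complex.norm_real, Real.norm_of_nonneg (Real.sqrt_nonneg _)]
      exact Real.sqrt_le_sqrt ((Complex.re_le_norm _).trans (norm_apply_le (g - f) x))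
    · ext x
      have h0 := Complex.le_def.mp (sub_nonneg.mpr (h x))
      have h1 : ((Real.sqrt (g x - f x).re : ℂ)) * (Real.sqrt (g x - f x).re : ℂ) = g x - f x := by
        rw [← Complex.ofReal_mul, Real.mul_self_sqrt h0.1]
        exact Complex.ext rfl h0.2
      rw [add_apply, mul_apply, star_apply, mk_apply]
      simp only [Complex.star_def, Complex.conj_ofReal, h1, add_sub_cancel]
  · rintro ⟨s, rfl⟩ x
    simpa using star_mul_self_nonneg (s x)

/-- Point evaluation as a star homomorphism. -/
def eval (x : X) : Linf X →⋆ₐ[ℂ] ℂ where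
  toFun f := f x
  map_one' := rfl
  map_mul' _ _ := rfl
  map_zero' := rfl
  map_add' _ _ := rfl
  commutes' _ := rfl
  map_star' _ := rfl

/-- Entrywise point evaluation of matrices over `Linf X`. -/
def evalMatrix (k : ℕ) (x : X) :
    CStarMatrix (Fin k) (Fin k) (Linf X) →⋆ₙₐ[ℂ] CStarMatrix (Fin k) (Fin k) ℂ :=
  CStarMatrix.mapₙₐ (NonUnitalStarAlgHomClass.toNonUnitalStarAlgHom (eval x))

theorem evalMatrix_apply (k : ℕ) (x : X) (M : CStarMatrix (Fin k) (Fin k) (Linf X)) (i j : Fin k) :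
    evalMatrix k x M i j = M i j x := rfl


/-- Positivity is detected by a jointly injective family of star homomorphisms. -/
theorem nonneg_of_forall_map {D E : Type*} {ι : Sort*} [NonUnitalCStarAlgebra D] [PartialOrder D]
    [StarOrderedRing D] [NonUnitalCStarAlgebra E] [PartialOrder E] [StarOrderedRing E]
    (φ : ι → D →⋆ₙₐ[ℂ] E) (hφ : ∀ a, (∀ i, φ i a = 0) → a = 0) {a : D} (ha : IsSelfAdjoint a)
    (h : ∀ i, 0 ≤ φ i a) : 0 ≤ a := by
  rw [← CFC.negPart_eq_zero_iff a ha]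
  refine hφ _ fun i => ?_
  have hi := (CFC.negPart_eq_zero_iff (φ i a) (IsSelfAdjoint.of_nonneg (h i))).mpr (h i)
  rw [CFC.negPart_def] at hi ⊢
  rw [← hi]
  exact NonUnitalStarAlgHomClass.map_cfcₙ (S := ℂ) (φ i) (fun x : ℝ => x⁻) a
    (hφ := map_continuous (φ i)) (hφa := IsSelfAdjoint.of_nonneg (h i))

theorem exists_star_mul_self {D : Type*} [NonUnitalCStarAlgebra D] [PartialOrder D]
    [StarOrderedRing D] {a : D} (ha : 0 ≤ a) : ∃ b, a = star b * b :=
  CStarAlgebra.nonneg_iff_eq_star_mul_self.mp ha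

/-- A matrix over `Linf X` is positive as soon as it is pointwise positive. -/
theorem matrix_nonneg {k : ℕ} {M : CStarMatrix (Fin k) (Fin k) (Linf X)}
    (h : ∀ x, 0 ≤ evalMatrix k x M) : 0 ≤ M := by
  refine nonneg_of_forall_map (evalMatrix k) (fun a ha => ?_) ?_ h
  · exact CStarMatrix.ext fun i j => Linf.ext fun x => congrArg (fun N => N i j) (ha x)
  · exact CStarMatrix.ext fun i j => Linf.ext fun x =>
      congrArg (fun N => N i j) (IsSelfAdjoint.of_nonneg (h x)).star_eq

open scoped MatrixOrder in
theorem matrix_nonneg_complex {k : ℕ} {M : CStarMatrix (Fin k) (Fin k) ℂ} (hM : IsSelfAdjoint M)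
    (h : ∀ v : Fin k → ℂ, 0 ≤ ∑ i, ∑ j, star (v i) * M i j * v j) : 0 ≤ M := by
  have h1 : Matrix.PosSemidef (CStarMatrix.ofMatrix.symm M) := by
    refine Matrix.PosSemidef.of_dotProduct_mulVec_nonneg hM fun v => ?_
    refine (h v).trans_eq ?_
    simp [dotProduct, Matrix.mulVec, Finset.mul_sum, mul_assoc]
  exact map_nonneg (CStarMatrix.ofMatrixStarAlgEquiv (n := Fin k) (A := ℂ)) h1.nonneg


theorem matrix_quadratic_nonneg {k : ℕ} {M : CStarMatrix (Fin k) (Fin k) (Linf X)} (hM : 0 ≤ M)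
    (x : X) (v : Fin k → ℂ) : 0 ≤ ∑ i, ∑ j, star (v i) * M i j x * v j := by
  obtain ⟨N, rfl⟩ := exists_star_mul_self hM
  have h1 : ∀ i j, (star N * N : CStarMatrix (Fin k) (Fin k) (Linf X)) i j x
      = ∑ l, star (N l i x) * N l j x := fun i j => by
    rw [CStarMatrix.mul_apply]
    exact map_sum (eval x) _ _
  have h2 : ∑ i, ∑ j, star (v i) * (star N * N : CStarMatrix (Fin k) (Fin k) (Linf X)) i j x * v j
      = ∑ l, star (∑ i, N l i x * v i) * (∑ i, N l i x * v i) := by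
    simp_rw [h1, star_sum, Finset.sum_mul_sum, Finset.mul_sum, Finset.sum_mul]
    rw [Finset.sum_comm_cycle]
    refine Finset.sum_congr rfl fun l _ => Finset.sum_congr rfl fun i _ =>
      Finset.sum_congr rfl fun j _ => ?_
    simp only [star_mul]
    ring
  refine le_of_le_of_eq ?_ h2.symm
  exact Finset.sum_nonneg fun l _ => star_mul_self_nonneg _

theorem integrable (f : Linf X) (μ : Measure X) [IsFiniteMeasure μ] : Integrable f μ :=
  Integrable.of_bound f.measurable.aestronglyMeasurable ‖f‖ (ae_of_all _ f.norm_apply_le)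

/-- The Koopman operator of a Markov kernel `κ`: `f ↦ (x ↦ ∫ f dκ(x))`. -/
def koopmanFun (κ : Kernel X Y) [IsMarkovKernel κ] (f : Linf Y) : Linf X :=
  mk (fun x => ∫ y, f y ∂(κ x)) f.measurable.stronglyMeasurable.integral_kernel.measurable ‖f‖
    fun x => (norm_integral_le_of_norm_le_const (ae_of_all _ f.norm_apply_le)).trans_eq (by simp)

@[simp] theorem koopmanFun_apply (κ : Kernel X Y) [IsMarkovKernel κ] (f : Linf Y) (x : X) :
    koopmanFun κ f x = ∫ y, f y ∂(κ x) := rfl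

/-- The Koopman operator is completely positive. -/
def koopmanCP (κ : Kernel X Y) [IsMarkovKernel κ] : Linf Y →CP Linf X where
  toFun := koopmanFun κ
  map_add' f g := ext fun x => integral_add (f.integrable _) (g.integrable _)
  map_smul' c f := ext fun x => integral_const_mul c _
  map_cstarMatrix_nonneg' k M hM := by
    refine matrix_nonneg fun x => matrix_nonneg_complex ?_ fun v => ?_
    · refine CStarMatrix.ext fun i j => ?_
      have h := congrArg (fun N => N i j) (IsSelfAdjoint.of_nonneg hM).star_eq
      change star (∫ y, M j i y ∂(κ x)) = ∫ y, M i j y ∂(κ x)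
      have h' : ∀ y, M i j y = star (M j i y) := fun y => congrArg (fun f : Linf Y => f y) h.symm
      simp_rw [h']
      exact integral_conj.symm
    · have h : ∑ i, ∑ j, star (v i) * (evalMatrix k x (M.map (koopmanFun κ))) i j * v j
          = ∫ y, ∑ i, ∑ j, star (v i) * M i j y * v j ∂(κ x) := by
        rw [integral_finsetSum]
        · refine Finset.sum_congr rfl fun i _ => ?_
          rw [integral_finsetSum]
          · refine Finset.sum_congr rfl fun j _ => ?_
            rw [integral_mul_const, integral_const_mul]
            rfl
          · exact fun j _ => (((M i j).integrable _).const_mul _).mul_const _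
        · exact fun i _ => integrable_finsetSum _ fun j _ =>
            (((M i j).integrable _).const_mul _).mul_const _
      refine le_of_le_of_eq ?_ h.symm
      exact integral_nonneg fun y => matrix_quadratic_nonneg hM y v


end Linf

section SigmaNotions

variable {A : Type u} {B : Type v}

/-- `(a n) ↗ s`: an increasing sequence of self-adjoint elements with supremum `s`. Such a sequence is
automatically norm bounded, since `a 0 ≤ a n ≤ s`. Every upper bound of a self-adjoint element is
self-adjoint, so the supremum in the algebra is the supremum in its self-adjoint part. -/
structure IncreasesTo [CStarAlgebra A] [PartialOrder A] (a : ℕ → A) (s : A) : Prop where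
  isSelfAdjoint : ∀ n, IsSelfAdjoint (a n)
  monotone : Monotone a
  isLUB : IsLUB (Set.range a) s

/-- The σC⋆-condition: every norm-bounded increasing sequence of self-adjoint elements has a
supremum. -/
def IsSigmaComplete (A : Type u) [CStarAlgebra A] [PartialOrder A] : Prop :=
  ∀ a : ℕ → A, (∀ n, IsSelfAdjoint (a n)) → Monotone a → (∃ C : ℝ, ∀ n, ‖a n‖ ≤ C) →
    ∃ s, IncreasesTo a s

/-- σ-normality: preservation of suprema of increasing sequences. -/
def IsSigmaNormal [CStarAlgebra A] [PartialOrder A] [Preorder B] (φ : A → B) : Prop :=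
  ∀ (a : ℕ → A) (s : A), IncreasesTo a s → IsLUB (Set.range fun n => φ (a n)) (φ s)

end SigmaNotions

namespace Linf

variable {X Y Z : Type u} [MeasurableSpace X] [MeasurableSpace Y] [MeasurableSpace Z]

theorem exists_pointwise_sup (a : ℕ → Linf X) (hsa : ∀ n, IsSelfAdjoint (a n)) (hmono : Monotone a)
    (hb : ∃ C : ℝ, ∀ n, ‖a n‖ ≤ C) :
    ∃ s : Linf X, IsLUB (Set.range a) s ∧ 
      ∀ x, Filter.Tendsto (fun n => a n x) Filter.atTop (nhds (s x)) := by
  obtain ⟨C, hC⟩ := hb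
  have hre : ∀ n x, a n x = ((a n x).re : ℂ) := fun n x =>
    (Complex.conj_eq_iff_re.mp (congrArg (fun f : Linf X => f x) (hsa n).star_eq)).symm
  have hm : ∀ x, Monotone fun n => (a n x).re := fun x i j h =>
    (Complex.le_def.mp (hmono h x)).1
  have hbd : ∀ n x, |(a n x).re| ≤ C := fun n x =>
    (Complex.abs_re_le_norm _).trans (((a n).norm_apply_le x).trans (hC n))
  have hbdd : ∀ x, BddAbove (Set.range fun n => (a n x).re) := fun x =>
    ⟨C, by rintro _ ⟨n, rfl⟩; exact (abs_le.mp (hbd n x)).2⟩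
  let s : Linf X := mk (fun x => ((⨆ n, (a n x).re : ℝ) : ℂ))
    (Complex.measurable_ofReal.comp
      (Measurable.iSup fun n => Complex.measurable_re.comp (a n).measurable)) C
    (fun x => by
      rw [Complex.norm_real, Real.norm_eq_abs, abs_le]
      exact ⟨(abs_le.mp (hbd 0 x)).1.trans (le_ciSup (hbdd x) 0),
        ciSup_le fun n => (abs_le.mp (hbd n x)).2⟩)
  refine ⟨s, ⟨?_, ?_⟩, fun x => ?_⟩
  · rintro _ ⟨n, rfl⟩ x
    rw [hre n x]
    exact Complex.real_le_real.mpr (le_ciSup (hbdd x) n)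
  · intro g hg x
    have h1 : ∀ n, (a n x).re ≤ (g x).re ∧ (a n x).im = (g x).im := fun n =>
      Complex.le_def.mp (hg ⟨n, rfl⟩ x)
    refine Complex.le_def.mpr ⟨ciSup_le fun n => (h1 n).1, ?_⟩
    rw [← (h1 0).2, hre 0 x]
    rfl
  · have := (Complex.continuous_ofReal.tendsto _).comp (tendsto_atTop_ciSup (hm x) (hbdd x))
    exact this.congr fun n => (hre n x).symm

theorem isSigmaComplete : IsSigmaComplete (Linf X) := fun a hsa hmono hb => by
  obtain ⟨s, hs, -⟩ := exists_pointwise_sup a hsa hmono hb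
  exact ⟨s, hsa, hmono, hs⟩

theorem norm_le_of_increasesTo {a : ℕ → Linf X} {s : Linf X} (h : IncreasesTo a s) (n : ℕ) :
    ‖a n‖ ≤ ‖a 0‖ + ‖s‖ := by
  refine norm_le (by positivity) fun y => ?_
  have h0 := Complex.le_def.mp (h.monotone (Nat.zero_le n) y)
  have h1 := Complex.le_def.mp (h.isLUB.1 ⟨n, rfl⟩ y)
  have hre : a n y = ((a n y).re : ℂ) :=
    (Complex.conj_eq_iff_re.mp (congrArg (fun f : Linf X => f y) (h.isSelfAdjoint n).star_eq)).symm
  rw [hre, Complex.norm_real, Real.norm_eq_abs, abs_le]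
  have h2 := abs_le.mp ((Complex.abs_re_le_norm _).trans ((a 0).norm_apply_le y))
  have h3 := abs_le.mp ((Complex.abs_re_le_norm _).trans (s.norm_apply_le y))
  constructor <;> linarith [h0.1, h1.1, h2.1, h3.2, norm_nonneg (a 0), norm_nonneg s]

theorem tendsto_of_increasesTo {a : ℕ → Linf X} {s : Linf X} (h : IncreasesTo a s) (x : X) :
    Filter.Tendsto (fun n => a n x) Filter.atTop (nhds (s x)) := by
  obtain ⟨t, ht, h'⟩ := exists_pointwise_sup a h.isSelfAdjoint h.monotone
    ⟨_, norm_le_of_increasesTo h⟩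
  rw [h.isLUB.unique ht]
  exact h' x

theorem isSigmaNormal_koopmanFun (κ : Kernel X Y) [IsMarkovKernel κ] :
    IsSigmaNormal (koopmanFun κ) := by
  intro a s h
  have hle : ∀ n, koopmanFun κ (a n) ≤ koopmanFun κ s := fun n x =>
    integral_mono ((a n).integrable _) (s.integrable _) (h.isLUB.1 ⟨n, rfl⟩)
  have hlim : ∀ x, Filter.Tendsto (fun n => koopmanFun κ (a n) x) Filter.atTop
      (nhds (koopmanFun κ s x)) := fun x =>
    tendsto_integral_of_dominated_convergence (fun _ => ‖a 0‖ + ‖s‖)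
      (fun n => (a n).measurable.aestronglyMeasurable) (integrable_const _)
      (fun n => ae_of_all _ fun y => ((a n).norm_apply_le y).trans (norm_le_of_increasesTo h n))
      (ae_of_all _ fun y => tendsto_of_increasesTo h y)
  refine ⟨by rintro _ ⟨n, rfl⟩; exact hle n, fun g hg x => ?_⟩
  exact le_of_tendsto' (hlim x) fun n => hg ⟨n, rfl⟩ x

end Linf

/-- σ-cpu maps: completely positive, unital, σ-normal (complex linear) maps. -/
structure SigmaCPUMap (A : Type u) (B : Type v) [CStarAlgebra A] [PartialOrder A]
    [StarOrderedRing A] [CStarAlgebra B] [PartialOrder B] [StarOrderedRing B]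
    extends CompletelyPositiveMap A B where
  map_one' : toFun 1 = 1
  isSigmaNormal' : IsSigmaNormal toFun

namespace SigmaCPUMap

variable {A B C : Type*} [CStarAlgebra A] [PartialOrder A] [StarOrderedRing A]
  [CStarAlgebra B] [PartialOrder B] [StarOrderedRing B]
  [CStarAlgebra C] [PartialOrder C] [StarOrderedRing C]

instance : FunLike (SigmaCPUMap A B) A B where
  coe φ := φ.toCompletelyPositiveMap
  coe_injective φ ψ h := by
    cases φ; cases ψ
    congr
    exact DFunLike.coe_injective h

@[ext] theorem ext {φ ψ : SigmaCPUMap A B} (h : ∀ a, φ a = ψ a) : φ = ψ := DFunLike.ext _ _ h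

theorem increasesTo (φ : SigmaCPUMap A B) {a : ℕ → A} {s : A} (h : IncreasesTo a s) :
    IncreasesTo (fun n => φ (a n)) (φ s) where
  isSelfAdjoint n :=
    (map_star (PositiveLinearMap.ofClass φ.toCompletelyPositiveMap) (a n)).symm.trans
      (congrArg φ (h.isSelfAdjoint n).star_eq)
  monotone := (OrderHomClass.mono φ.toCompletelyPositiveMap).comp h.monotone
  isLUB := φ.isSigmaNormal' a s h

/-- The identity. -/
protected def id (A : Type*) [CStarAlgebra A] [PartialOrder A] [StarOrderedRing A] :
    SigmaCPUMap A A where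
  toLinearMap := LinearMap.id
  map_cstarMatrix_nonneg' _ _ hM := hM
  map_one' := rfl
  isSigmaNormal' _ _ h := h.isLUB

/-- Composition. -/
def comp (ψ : SigmaCPUMap B C) (φ : SigmaCPUMap A B) : SigmaCPUMap A C where
  toLinearMap := ψ.toLinearMap ∘ₗ φ.toLinearMap
  map_cstarMatrix_nonneg' k M hM :=
    ψ.map_cstarMatrix_nonneg' k _ (φ.map_cstarMatrix_nonneg' k M hM)
  map_one' := (congrArg ψ φ.map_one').trans ψ.map_one'
  isSigmaNormal' _ _ h := ψ.isSigmaNormal' _ _ (φ.increasesTo h)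

end SigmaCPUMap

/-- Commutative σC⋆-algebras. The order is the C⋆-algebra order: `StarOrderedRing` forces it. Morphisms
are the σ-cpu maps. The zero algebra is allowed (it corresponds to the empty space). -/
structure CommSigmaCStar : Type (u + 1) where
  carrier : Type u
  [commCStarAlgebra : CommCStarAlgebra carrier]
  [partialOrder : PartialOrder carrier]
  [starOrderedRing : StarOrderedRing carrier]
  isSigmaComplete : IsSigmaComplete carrier

namespace CommSigmaCStar

instance : CoeSort CommSigmaCStar.{u} (Type u) := ⟨carrier⟩
attribute [instance] commCStarAlgebra partialOrder starOrderedRing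

instance : Category CommSigmaCStar.{u} where
  Hom A B := SigmaCPUMap A B
  id A := SigmaCPUMap.id A
  comp φ ψ := SigmaCPUMap.comp ψ φ

instance (A B : CommSigmaCStar.{u}) : FunLike (A ⟶ B) A B :=
  inferInstanceAs (FunLike (SigmaCPUMap A B) A B)

end CommSigmaCStar

/-- The Koopman operator as a σ-cpu map. -/
def koopmanMap {X Y : Type u} [MeasurableSpace X] [MeasurableSpace Y] (κ : Kernel X Y)
    [IsMarkovKernel κ] : SigmaCPUMap (Linf Y) (Linf X) where
  toCompletelyPositiveMap := Linf.koopmanCP κ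
  map_one' := Linf.ext fun x => by
    change ∫ _, (1 : ℂ) ∂(κ x) = 1
    simp
  isSigmaNormal' := Linf.isSigmaNormal_koopmanFun κ

/-- The Markov kernel underlying a morphism of `Stoch`, the category of measurable spaces and Markov
kernels. -/
abbrev stochKernel {X Y : Stoch.{u}} (κ : X ⟶ Y) : Kernel X.obj Y.obj := κ.hom.hom

/-- The contravariant functor from Markov kernels to commutative σC⋆-algebras with σ-cpu maps: it sends
`X` to the bounded measurable functions on `X` and a Markov kernel to its Koopman operator. -/
def koopman : Stoch.{u}ᵒᵖ ⥤ CommSigmaCStar.{u} where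
  obj X := { carrier := Linf X.unop.obj, isSigmaComplete := Linf.isSigmaComplete }
  map κ := koopmanMap (stochKernel κ.unop)
  map_id X := SigmaCPUMap.ext fun f => Linf.ext fun x => by
    change ∫ y, f y ∂(Kernel.id x) = f x
    rw [Kernel.id_apply, integral_dirac' _ _ f.measurable.stronglyMeasurable]
  map_comp {X Y Z} κ μ := SigmaCPUMap.ext fun f => Linf.ext fun x => by
    exact Kernel.integral_comp (f.integrable ((stochKernel κ.unop ∘ₖ stochKernel μ.unop) x))

section PureStates

variable (A : Type u) [CStarAlgebra A] [PartialOrder A]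

/-- The convex set of states: positive unital linear functionals. -/
def states : Set (A →ₗ[ℂ] ℂ) := {φ | (∀ a, 0 ≤ a → 0 ≤ φ a) ∧ φ 1 = 1}

/-- Pure σ-states: σ-normal states which are extreme in the set of all states. -/
def pureSigmaStates : Set (A →ₗ[ℂ] ℂ) :=
  {φ | φ ∈ (states A).extremePoints ℝ ∧ IsSigmaNormal φ}

/-- The pure σ-states separate the positive elements from zero. -/
def IsPurelySigmaRepresentable : Prop :=
  ∀ x : A, 0 ≤ x → (∀ φ ∈ pureSigmaStates A, φ x = 0) → x = 0

end PureStates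

section UniversalRepresentation

/-- The Hilbert space of the universal representation: the Hilbert sum of the GNS spaces of all
states of `A`. -/
abbrev UnivHilbert (A : Type u) [CStarAlgebra A] [PartialOrder A] [StarOrderedRing A] : Type u :=
  lp (fun φ : {φ : A →ₚ[ℂ] ℂ // φ 1 = 1} => φ.1.GNS) 2

variable {A : Type u} [CStarAlgebra A] [PartialOrder A] [StarOrderedRing A]

/-- The action of `a` on the Hilbert sum: in each summand, its GNS representation. -/
def universalRepFun (a : A) : UnivHilbert A →L[ℂ] UnivHilbert A :=
  lp.mapCLM 2 (fun φ : {φ : A →ₚ[ℂ] ℂ // φ 1 = 1} => φ.1.gnsStarAlgHom a) (norm_nonneg a)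
    fun φ => NonUnitalStarAlgHom.norm_apply_le φ.1.gnsStarAlgHom a

theorem universalRepFun_apply (a : A) (ξ : UnivHilbert A) (φ : {φ : A →ₚ[ℂ] ℂ // φ 1 = 1}) :
    universalRepFun a ξ φ = φ.1.gnsStarAlgHom a (ξ φ) := rfl

variable (A) in
/-- The universal representation of `A`: the direct sum of the GNS representations of all states. -/
def universalRep : A →⋆ₐ[ℂ] (UnivHilbert A →L[ℂ] UnivHilbert A) where
  toFun := universalRepFun
  map_one' := ContinuousLinearMap.ext fun ξ => lp.ext <| funext fun φ => by
    rw [universalRepFun_apply, map_one]; rfl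
  map_mul' a b := ContinuousLinearMap.ext fun ξ => lp.ext <| funext fun φ => by
    rw [universalRepFun_apply, map_mul]; rfl
  map_zero' := ContinuousLinearMap.ext fun ξ => lp.ext <| funext fun φ => by
    rw [universalRepFun_apply, map_zero]; rfl
  map_add' a b := ContinuousLinearMap.ext fun ξ => lp.ext <| funext fun φ => by
    rw [universalRepFun_apply, map_add]; rfl
  commutes' r := ContinuousLinearMap.ext fun ξ => lp.ext <| funext fun φ => by
    rw [universalRepFun_apply, AlgHomClass.commutes]; rfl
  map_star' a := by
    refine (ContinuousLinearMap.eq_adjoint_iff _ _).mpr fun ξ η => ?_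
    rw [lp.inner_eq_tsum, lp.inner_eq_tsum]
    refine tsum_congr fun φ => ?_
    rw [universalRepFun_apply, universalRepFun_apply, map_star]
    exact ContinuousLinearMap.adjoint_inner_left _ _ _
end UniversalRepresentation

section PedersenBaire

/-- The smallest linear subspace which contains `W`, is closed under the involution, and is σ-closed:
it contains the supremum of each increasing sequence of its elements. The supremum is that of `B`. -/
def sigmaClosure {B : Type u} [CStarAlgebra B] [PartialOrder B] (W : Set B) : Set B :=
  {b | ∀ V : Submodule ℂ B, W ⊆ V → (∀ x ∈ V, star x ∈ V) →
    (∀ (a : ℕ → B) (s : B), (∀ n, a n ∈ V) → IncreasesTo a s → s ∈ V) → b ∈ V}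

/-- `B` is (isomorphic as a unital star algebra to) the Pedersen–Baire envelope of `A`: the σ-closure
of `A` in the algebra of bounded operators on the Hilbert space of its universal representation.
Operators carry the Loewner order. -/
def IsPedersenBaireEnvelope (A : Type u) [CStarAlgebra A] [PartialOrder A] [StarOrderedRing A]
    (B : Type v) [CStarAlgebra B] : Prop :=
  ∃ ι : B →⋆ₐ[ℂ] (UnivHilbert A →L[ℂ] UnivHilbert A),
    Function.Injective ι ∧ Set.range ι = sigmaClosure (Set.range (universalRep A))

end PedersenBaire

namespace CommSigmaCStar

/-- Purely σ-representable algebras. -/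
def isPure : ObjectProperty CommSigmaCStar.{u} := fun A => IsPurelySigmaRepresentable A

/-- Commutative Pedersen–Baire envelopes. -/
def isPedBaire : ObjectProperty CommSigmaCStar.{u} := fun B =>
  ∃ (A : Type u) (_ : CStarAlgebra A) (_ : PartialOrder A) (_ : StarOrderedRing A),
    IsPedersenBaireEnvelope A B

/-- Commutative Pedersen–Baire envelopes of separable C⋆-algebras. -/
def isPedBaireSep : ObjectProperty CommSigmaCStar.{u} := fun B =>
  ∃ (A : Type u) (_ : CStarAlgebra A) (_ : PartialOrder A) (_ : StarOrderedRing A),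
    TopologicalSpace.SeparableSpace A ∧ IsPedersenBaireEnvelope A B

end CommSigmaCStar

/-- The Gelfand σ-spectrum: the σ-normal unital star homomorphisms to `ℂ`. -/
def SigmaSpectrum (A : Type u) [CStarAlgebra A] [PartialOrder A] : Type u :=
  {χ : A →⋆ₐ[ℂ] ℂ // IsSigmaNormal χ}

/-- The smallest σ-algebra making the evaluations measurable. -/
instance (A : Type u) [CStarAlgebra A] [PartialOrder A] : MeasurableSpace (SigmaSpectrum A) :=
  ⨆ a : A, (borel ℂ).comap fun χ => χ.1 a

/-- The Gelfand σ-spectrum as an object of `Stoch`. -/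
def specStoch (A : CommSigmaCStar.{u}) : Stoch.{u} := ⟨SFinKer.of (SigmaSpectrum A)⟩

/-- A functorial (contravariant) action of the Gelfand σ-spectrum on σ-cpu maps between purely
σ-representable algebras: `φ : A ⟶ B` gives a Markov kernel from the spectrum of `B` to that of `A`
which sends `ψ` to a probability measure representing the state `ψ ∘ φ`. The existence of such an
action is never assumed below: it is part of what is asserted. Since the evaluations generate the
σ-algebra, the formula for the integrals determines `map`. -/
structure SpecAction where
  map {A B : CommSigmaCStar.isPure.{u}.FullSubcategory} (φ : A ⟶ B) :
    specStoch B.obj ⟶ specStoch A.obj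
  map_id (A : CommSigmaCStar.isPure.{u}.FullSubcategory) : map (𝟙 A) = 𝟙 (specStoch A.obj)
  map_comp {A B C : CommSigmaCStar.isPure.{u}.FullSubcategory} (φ : A ⟶ B) (ψ : B ⟶ C) :
    map (φ ≫ ψ) = map ψ ≫ map φ
  integral_map {A B : CommSigmaCStar.isPure.{u}.FullSubcategory} (φ : A ⟶ B)
    (ψ : SigmaSpectrum B.obj) (a : A.obj) :
    ∫ χ : SigmaSpectrum A.obj, χ.1 a ∂(stochKernel (map φ) ψ) = ψ.1 (φ.hom a)

/-- The resulting functor. -/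
def SpecAction.functor (S : SpecAction.{u}) :
    CommSigmaCStar.isPure.{u}.FullSubcategoryᵒᵖ ⥤ Stoch.{u} where
  obj A := specStoch A.unop.obj
  map φ := S.map φ.unop
  map_id A := S.map_id A.unop
  map_comp φ ψ := S.map_comp ψ.unop φ.unop

/-- The σ-algebra is the Baire σ-algebra of some compact Hausdorff topology, i.e. the smallest one
making all continuous functions `X → ℝ` measurable. -/
def IsBaireMeasurableSpace (X : Type u) [m : MeasurableSpace X] : Prop :=
  ∃ _ : TopologicalSpace X, CompactSpace X ∧ T2Space X ∧ m = ⨆ f : C(X, ℝ), (borel ℝ).comap f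

/-- The objects of the full subcategory `BaireStoch`. -/
def isBaire : ObjectProperty Stoch.{u} := fun X => IsBaireMeasurableSpace X.obj

/-- The objects of the full subcategory `StBorelStoch`. -/
def isStandardBorel : ObjectProperty Stoch.{u} := fun X => StandardBorelSpace X.obj

/-- `koopman` and the spectrum functor restrict to mutually inverse contravariant equivalences between
the full subcategory `P` of `Stoch` and the full subcategory `Q` of purely σ-representable algebras:
`Q` consists of purely σ-representable algebras, `koopman` maps `P` into `Q`, the spectrum maps `Q`
into `P`, and the two restrictions are the two functors of an equivalence of categories. -/
def RestrictsToDuality (P : ObjectProperty Stoch.{u}) (Q : ObjectProperty CommSigmaCStar.{u})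
    (S : SpecAction.{u}) : Prop :=
  ∃ (hQ : Q ≤ CommSigmaCStar.isPure)
    (hL : ∀ X : P.FullSubcategoryᵒᵖ, Q (koopman.obj (.op X.unop.obj)))
    (hS : ∀ A : Q.FullSubcategoryᵒᵖ, P (specStoch A.unop.obj))
    (e : P.FullSubcategoryᵒᵖ ≌ Q.FullSubcategory),
    e.functor = Q.lift (P.ι.op ⋙ koopman) hL ∧
    e.inverse = (P.lift ((ObjectProperty.ιOfLE hQ).op ⋙ S.functor) hS).rightOp

end

noncomputable section

open Filter Topology

/-! A σ-closed subspace of `Linf X` containing the constants and a family of functions that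
generates the σ-algebra, is stable under products and is stable under composition with continuous
functions is everything: the supports of the family form a π-system, their indicators are
increasing limits of members of the family, and every bounded measurable function is built from
indicators by linear combinations and increasing limits.

Hence a σ-cpu map `Linf Y → Linf X` is determined by its values on indicators, which form a Markov
kernel, so `koopman` is fully faithful. Pure states of a commutative algebra are multiplicative;
hence for a purely σ-representable algebra the Gelfand transform on the σ-spectrum is injective,
and it is onto `Linf` because its range is σ-closed and generates the σ-algebra.

For a compact Hausdorff space `K` with its Baire σ-algebra, integration against the spectral
measures extends the universal representation of `C(K)` to `Linf K`. Point evaluations are states,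
hence vector functionals in the universal representation, so the extension is injective and its
range is the σ-closure of `C(K)`: the Pedersen–Baire envelope of `C(K)` is `Linf K`, and its
σ-spectrum is `K`. Finally `C(K)` is separable if and only if `K` is metrizable. -/

/-! ### Monotone classes of bounded measurable functions -/

/-- A subspace is σ-closed if it contains the supremum of each increasing sequence of its
self-adjoint elements; `sigmaClosure` is an intersection of star-closed such subspaces. -/
def IsSigmaClosed {B : Type*} [CStarAlgebra B] [PartialOrder B] (V : Submodule ℂ B) : Prop :=
  ∀ (a : ℕ → B) (s : B), (∀ n, a n ∈ V) → IncreasesTo a s → s ∈ V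

theorem isSigmaClosed_eqLocus {A B : Type*} [CStarAlgebra A] [PartialOrder A]
    [CStarAlgebra B] [PartialOrder B] {φ ψ : A →ₗ[ℂ] B} (hφ : IsSigmaNormal φ)
    (hψ : IsSigmaNormal ψ) : IsSigmaClosed (LinearMap.eqLocus φ ψ) := by
  intro a s ha h
  have hφs := hφ a s h
  rw [show (fun n => φ (a n)) = fun n => ψ (a n) from funext ha] at hφs
  exact hφs.unique (hψ a s h)

namespace Linf

variable {X : Type*} [MeasurableSpace X]

theorem sum_apply {ι : Type*} (s : Finset ι) (f : ι → Linf X) (x : X) :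
    (∑ i ∈ s, f i) x = ∑ i ∈ s, f i x :=
  map_sum (eval x) f s

theorem isSelfAdjoint_iff {f : Linf X} : IsSelfAdjoint f ↔ ∀ x, ((f x).re : ℂ) = f x :=
  DFunLike.ext_iff.trans (forall_congr' fun _ => Complex.conj_eq_iff_re)

theorem increasesTo_of_tendsto {a : ℕ → Linf X} {s : Linf X} (hsa : ∀ n, IsSelfAdjoint (a n))
    (hmono : Monotone a) (h : ∀ x, Tendsto (fun n => a n x) atTop (𝓝 (s x))) :
    IncreasesTo a s where
  isSelfAdjoint := hsa
  monotone := hmono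
  isLUB := by
    refine ⟨?_, fun g hg x => le_of_tendsto' (h x) fun n => hg ⟨n, rfl⟩ x⟩
    rintro _ ⟨n, rfl⟩ x
    exact Monotone.ge_of_tendsto (fun i j hij => hmono hij x) (h x) n

/-- A bounded measurable real function as an element of `Linf X`. -/
def ofReal (f : X → ℝ) (hf : Measurable f) (C : ℝ) (hC : ∀ x, |f x| ≤ C) : Linf X :=
  mk (fun x => (f x : ℂ)) (Complex.measurable_ofReal.comp hf) C fun x => by
    rw [Complex.norm_real]; exact hC x

@[simp] theorem ofReal_apply (f : X → ℝ) (hf : Measurable f) (C : ℝ) (hC : ∀ x, |f x| ≤ C)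
    (x : X) : ofReal f hf C hC x = f x := rfl

theorem isSelfAdjoint_ofReal (f : X → ℝ) (hf : Measurable f) (C : ℝ) (hC : ∀ x, |f x| ≤ C) :
    IsSelfAdjoint (ofReal f hf C hC) :=
  isSelfAdjoint_iff.mpr fun x => by simp

/-- The indicator function of a measurable set. -/
def indicator (E : Set X) (hE : MeasurableSet E) : Linf X :=
  ofReal (E.indicator 1) (measurable_one.indicator hE) 1 fun x => by
    by_cases h : x ∈ E <;> simp [h]

theorem indicator_of_mem {E : Set X} {hE : MeasurableSet E} {x : X} (h : x ∈ E) :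
    indicator E hE x = 1 := by simp [indicator, h]

theorem indicator_of_notMem {E : Set X} {hE : MeasurableSet E} {x : X} (h : x ∉ E) :
    indicator E hE x = 0 := by simp [indicator, h]

theorem indicator_nonneg (E : Set X) (hE : MeasurableSet E) : 0 ≤ indicator E hE := fun x =>
  Complex.zero_le_real.mpr (Set.indicator_nonneg (fun _ _ => zero_le_one) x)

theorem indicator_empty : indicator (∅ : Set X) .empty = 0 :=
  ext fun _ => indicator_of_notMem (Set.notMem_empty _)

theorem indicator_univ : indicator (Set.univ : Set X) .univ = 1 :=
  ext fun _ => indicator_of_mem (Set.mem_univ _)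

theorem indicator_compl {E : Set X} (hE : MeasurableSet E) :
    indicator Eᶜ hE.compl = 1 - indicator E hE := by
  ext x
  by_cases hx : x ∈ E
  · rw [indicator_of_notMem (not_not.mpr hx), sub_apply, indicator_of_mem hx, one_apply, sub_self]
  · rw [indicator_of_mem hx, sub_apply, indicator_of_notMem hx, one_apply, sub_zero]

theorem sum_indicator {ι : Type*} {E : ι → Set X} (hE : ∀ i, MeasurableSet (E i))
    (hd : Pairwise (Function.onFun Disjoint E)) (s : Finset ι) :
    ∑ i ∈ s, indicator (E i) (hE i)
      = indicator (⋃ i ∈ s, E i) (s.measurableSet_biUnion fun i _ => hE i) := by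
  ext x
  rw [sum_apply]
  simp only [indicator, ofReal_apply]
  rw [Finset.indicator_biUnion_apply s E fun i _ j _ hij => hd hij, Complex.ofReal_sum]

theorem increasesTo_sum_indicator {E : ℕ → Set X} (hE : ∀ i, MeasurableSet (E i))
    (hd : Pairwise (Function.onFun Disjoint E)) :
    IncreasesTo (fun n => ∑ i ∈ Finset.range n, indicator (E i) (hE i))
      (indicator (⋃ i, E i) (.iUnion hE)) := by
  refine increasesTo_of_tendsto (fun n => ?_) ?_ fun x => ?_
  · exact isSelfAdjoint_sum _ fun i _ => isSelfAdjoint_ofReal _ _ _ _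
  · refine monotone_nat_of_le_succ fun n => ?_
    rw [Finset.sum_range_succ]
    exact le_add_of_nonneg_right (indicator_nonneg _ _)
  · simp_rw [sum_indicator hE hd]
    exact (Complex.continuous_ofReal.tendsto _).comp (((tendsto_indicator_biUnion_finset E 1 x).comp
      tendsto_finset_range).mono_right (pure_le_nhds _))

theorem mem_of_finite_range {V : Submodule ℂ (Linf X)} (hind : ∀ E hE, indicator E hE ∈ V)
    {f : Linf X} (hf : (Set.range f).Finite) : f ∈ V := by
  have hlevel (c : ℂ) : MeasurableSet (f ⁻¹' {c}) := f.measurable (measurableSet_singleton c)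
  have hsum : f = ∑ c ∈ hf.toFinset, c • indicator (f ⁻¹' {c}) (hlevel c) := by
    ext x
    rw [sum_apply, Finset.sum_eq_single_of_mem (f x) (by simp), smul_apply,
      indicator_of_mem (E := f ⁻¹' {f x}) rfl, mul_one]
    intro c _ hc
    rw [smul_apply, indicator_of_notMem (E := f ⁻¹' {c}) fun h => hc (Eq.symm h), mul_zero]
  rw [hsum]
  exact V.sum_mem fun c _ => V.smul_mem c (hind _ _)

/-- The dyadic approximation `⌊2ⁿ f⌋ / 2ⁿ` of the real part of `f`, meant for `0 ≤ f`: the natural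
floor truncates negative values to `0`. -/
def dyadicFloor (f : Linf X) (n : ℕ) : Linf X :=
  ofReal (fun x => (⌊2 ^ n * (f x).re⌋₊ : ℝ) / 2 ^ n)
    (by have := f.measurable; fun_prop) ‖f‖ fun x => by
      rw [abs_of_nonneg (by positivity), div_le_iff₀ (by positivity)]
      refine (Nat.floor_le_floor (b := ‖f‖ * 2 ^ n) ?_ |> Nat.cast_le.mpr).trans
        (Nat.floor_le (by positivity))
      rw [mul_comm]
      gcongr
      exact (Complex.re_le_norm _).trans (f.norm_apply_le x)

theorem finite_range_dyadicFloor (f : Linf X) (n : ℕ) : (Set.range (dyadicFloor f n)).Finite := by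
  refine ((Set.finite_Iic ⌊2 ^ n * ‖f‖⌋₊).image fun k : ℕ => ((k / 2 ^ n : ℝ) : ℂ)).subset ?_
  rintro _ ⟨x, rfl⟩
  refine ⟨_, Nat.floor_le_floor ?_, rfl⟩
  gcongr
  exact (Complex.re_le_norm _).trans (f.norm_apply_le x)

theorem monotone_dyadicFloor (f : Linf X) : Monotone (dyadicFloor f) := by
  refine monotone_nat_of_le_succ fun n x => Complex.real_le_real.mpr ?_
  have hfloor (t : ℝ) : 2 * ⌊t⌋₊ ≤ ⌊2 * t⌋₊ := by
    rcases le_total 0 t with ht | ht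
    · refine Nat.le_floor ?_
      push_cast
      gcongr
      exact Nat.floor_le ht
    · simp [Nat.floor_of_nonpos ht]
  beta_reduce
  rw [← mul_div_mul_left _ ((2 : ℝ) ^ n) two_ne_zero, ← pow_succ']
  gcongr
  rw [pow_succ', mul_assoc]
  exact_mod_cast hfloor _

theorem increasesTo_dyadicFloor {f : Linf X} (hf : 0 ≤ f) : IncreasesTo (dyadicFloor f) f := by
  refine increasesTo_of_tendsto (fun n => isSelfAdjoint_ofReal _ _ _ _) (monotone_dyadicFloor f)
    fun x => ?_
  rw [← isSelfAdjoint_iff.mp (.of_nonneg hf) x]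
  refine (Complex.continuous_ofReal.tendsto _).comp ?_
  simpa only [mul_comm] using! (tendsto_nat_floor_mul_div_atTop (Complex.le_def.mp (hf x)).1).comp
    (tendsto_pow_atTop_atTop_of_one_lt (one_lt_two (α := ℝ)))

theorem mem_of_forall_indicator_mem {V : Submodule ℂ (Linf X)} (hV : IsSigmaClosed V)
    (hind : ∀ E hE, indicator E hE ∈ V) (f : Linf X) : f ∈ V := by
  have hnonneg : {g : Linf X | 0 ≤ g} ⊆ V := fun g hg =>
    hV _ _ (fun n => mem_of_finite_range hind (finite_range_dyadicFloor g n))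
      (increasesTo_dyadicFloor hg)
  exact Submodule.span_le.mpr hnonneg (CStarAlgebra.span_nonneg (A := Linf X) ▸ Submodule.mem_top)

theorem mem_of_isPiSystem {V : Submodule ℂ (Linf X)} (hV : IsSigmaClosed V) (hone : 1 ∈ V)
    {S : Set (Set X)} (hS : IsPiSystem S)
    (hgen : ‹MeasurableSpace X› = MeasurableSpace.generateFrom S)
    (hind : ∀ E ∈ S, ∀ hE, indicator E hE ∈ V) (f : Linf X) : f ∈ V := by
  refine mem_of_forall_indicator_mem hV (fun E hE => ?_) f
  induction E, hE using MeasurableSpace.induction_on_inter hgen hS with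
  | empty => exact indicator_empty (X := X) ▸ V.zero_mem
  | basic E hES => exact hind E hES _
  | compl E hE ih => exact indicator_compl hE ▸ V.sub_mem hone ih
  | iUnion E hd hE ih =>
    exact hV _ _ (fun n => V.sum_mem fun i _ => ih i) (increasesTo_sum_indicator hE hd)

theorem generateFrom_support {T : Set (Linf X)}
    (hcomp : ∀ f ∈ T, ∀ g : C(ℂ, ℂ), ∃ h ∈ T, ∀ x, h x = g (f x))
    (hgen : ‹MeasurableSpace X› ≤ ⨆ f ∈ T, (borel ℂ).comap f) :
    ‹MeasurableSpace X›
      = MeasurableSpace.generateFrom ((fun f : Linf X => Function.support f) '' T) := by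
  refine le_antisymm (hgen.trans (iSup₂_le fun f hf => ?_)) (MeasurableSpace.generateFrom_le ?_)
  · rw [borel, MeasurableSpace.comap_generateFrom]
    refine MeasurableSpace.generateFrom_le ?_
    rintro _ ⟨U, hU, rfl⟩
    obtain ⟨g, hg, -⟩ := perfectlyNormalSpace_iff_forall_isClosed_preimage_zero.mp inferInstance
      Uᶜ (IsOpen.isClosed_compl hU)
    obtain ⟨h, hT, hh⟩ := hcomp f hf ⟨fun z => (g z : ℂ), by fun_prop⟩
    refine MeasurableSpace.measurableSet_generateFrom ⟨h, hT, ?_⟩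
    ext x
    have hzero : f x ∈ Uᶜ ↔ g (f x) = 0 := by rw [hg]; rfl
    simp [hh, ← hzero]
  · rintro _ ⟨f, -, rfl⟩
    exact measurableSet_support f.measurable

theorem increasesTo_indicator_support (f : Linf X) {a : ℕ → Linf X}
    (ha : ∀ n x, a n x = ((min 1 (n * ‖f x‖) : ℝ) : ℂ)) :
    IncreasesTo a
      (indicator (Function.support f) (measurableSet_support f.measurable)) := by
  refine increasesTo_of_tendsto (fun n => isSelfAdjoint_iff.mpr fun x => ?_) (fun i j hij x => ?_)
    fun x => ?_
  · rw [ha, Complex.ofReal_re]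
  · rw [ha, ha]
    refine Complex.real_le_real.mpr (min_le_min_left _ ?_)
    gcongr
  · simp only [ha]
    by_cases hx : f x = 0
    · rw [indicator_of_notMem (Function.notMem_support.mpr hx)]
      simp [hx]
    · rw [indicator_of_mem hx]
      have hlarge : ∀ᶠ n : ℕ in atTop, 1 ≤ n * ‖f x‖ :=
        (tendsto_natCast_atTop_atTop.atTop_mul_const (norm_pos_iff.mpr hx)).eventually_ge_atTop 1
      refine tendsto_const_nhds.congr' ?_
      filter_upwards [hlarge] with n hn
      rw [min_eq_left hn, Complex.ofReal_one]

theorem mem_of_generating {V : Submodule ℂ (Linf X)} (hV : IsSigmaClosed V) (hone : 1 ∈ V)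
    {T : Set (Linf X)} (hTV : T ⊆ V) (hmul : ∀ f ∈ T, ∀ g ∈ T, f * g ∈ T)
    (hcomp : ∀ f ∈ T, ∀ g : C(ℂ, ℂ), ∃ h ∈ T, ∀ x, h x = g (f x))
    (hgen : ‹MeasurableSpace X› ≤ ⨆ f ∈ T, (borel ℂ).comap f) (f : Linf X) : f ∈ V := by
  refine mem_of_isPiSystem hV hone ?_ (generateFrom_support hcomp hgen) ?_ f
  · rintro _ ⟨f, hf, rfl⟩ _ ⟨g, hg, rfl⟩ -
    exact ⟨f * g, hmul f hf g hg, Function.support_mul' _ _⟩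
  · rintro _ ⟨f, hf, rfl⟩ _
    choose a haT ha using fun n : ℕ => hcomp f hf
      ⟨fun z => ((min 1 (n * ‖z‖) : ℝ) : ℂ), by fun_prop⟩
    exact hV a _ (fun n => hTV (haT n)) (increasesTo_indicator_support f ha)

end Linf

/-! ### Markov kernels from σ-cpu maps -/

namespace SigmaCPUMap

variable {A B : Type*} [CStarAlgebra A] [PartialOrder A] [StarOrderedRing A]
  [CStarAlgebra B] [PartialOrder B] [StarOrderedRing B]

instance : LinearMapClass (SigmaCPUMap A B) ℂ A B where
  map_add φ := map_add φ.toCompletelyPositiveMap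
  map_smulₛₗ φ := map_smul φ.toCompletelyPositiveMap

instance : CompletelyPositiveMapClass (SigmaCPUMap A B) A B where
  map_cstarMatrix_nonneg' φ := φ.map_cstarMatrix_nonneg'

instance : OneHomClass (SigmaCPUMap A B) A B where
  map_one φ := φ.map_one'

variable {X Y : Type*} [MeasurableSpace X] [MeasurableSpace Y]

theorem ext_indicator {φ ψ : SigmaCPUMap (Linf Y) B}
    (h : ∀ E hE, φ (Linf.indicator E hE) = ψ (Linf.indicator E hE)) : φ = ψ :=
  SigmaCPUMap.ext fun f => Linf.mem_of_forall_indicator_mem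
    (isSigmaClosed_eqLocus (φ := φ.toLinearMap) (ψ := ψ.toLinearMap)
      φ.isSigmaNormal' ψ.isSigmaNormal') h f

theorem re_map_indicator_nonneg (φ : SigmaCPUMap (Linf Y) (Linf X)) (E : Set Y)
    (hE : MeasurableSet E) (x : X) : 0 ≤ (φ (Linf.indicator E hE) x).re :=
  (Complex.le_def.mp (map_nonneg φ (Linf.indicator_nonneg E hE) x)).1

theorem hasSum_re_map_indicator (φ : SigmaCPUMap (Linf Y) (Linf X)) {E : ℕ → Set Y}
    (hE : ∀ i, MeasurableSet (E i)) (hd : Pairwise (Function.onFun Disjoint E)) (x : X) :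
    HasSum (fun i => (φ (Linf.indicator (E i) (hE i)) x).re)
      (φ (Linf.indicator (⋃ i, E i) (.iUnion hE)) x).re := by
  rw [hasSum_iff_tendsto_nat_of_nonneg fun i => φ.re_map_indicator_nonneg _ _ x]
  refine ((Complex.continuous_re.tendsto _).comp (Linf.tendsto_of_increasesTo
    (φ.increasesTo (Linf.increasesTo_sum_indicator hE hd)) x)).congr fun n => ?_
  rw [Function.comp_apply, map_sum, Linf.sum_apply, Complex.re_sum]

/-- The measure `E ↦ φ(1_E)(x)`: the value at `x` of the Markov kernel whose Koopman operator is
`φ`. -/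
def measure (φ : SigmaCPUMap (Linf Y) (Linf X)) (x : X) : Measure Y :=
  Measure.ofMeasurable (fun E hE => ENNReal.ofReal (φ (Linf.indicator E hE) x).re)
    (by simp [Linf.indicator_empty])
    fun E hE hd => by
      have hsum := φ.hasSum_re_map_indicator hE hd x
      rw [← hsum.tsum_eq, ENNReal.ofReal_tsum_of_nonneg
        (fun i => φ.re_map_indicator_nonneg _ _ x) hsum.summable]

theorem measure_apply (φ : SigmaCPUMap (Linf Y) (Linf X)) (x : X) {E : Set Y}
    (hE : MeasurableSet E) :
    φ.measure x E = ENNReal.ofReal (φ (Linf.indicator E hE) x).re :=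
  Measure.ofMeasurable_apply E hE

/-- The Markov kernel whose Koopman operator is `φ`. -/
def kernel (φ : SigmaCPUMap (Linf Y) (Linf X)) : Kernel X Y where
  toFun := φ.measure
  measurable' := Measure.measurable_of_measurable_coe _ fun E hE => by
    simp_rw [φ.measure_apply _ hE]
    exact (Complex.measurable_re.comp (φ (Linf.indicator E hE)).measurable).ennreal_ofReal

instance (φ : SigmaCPUMap (Linf Y) (Linf X)) : IsMarkovKernel φ.kernel where
  isProbabilityMeasure x := ⟨by
    refine (φ.measure_apply x .univ).trans ?_
    rw [Linf.indicator_univ, map_one, Linf.one_apply, Complex.one_re, ENNReal.ofReal_one]⟩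

end SigmaCPUMap

section Koopman

variable {X Y : Type u} [MeasurableSpace X] [MeasurableSpace Y]

theorem koopmanMap_indicator_apply (κ : Kernel X Y) [IsMarkovKernel κ] (E : Set Y)
    (hE : MeasurableSet E) (x : X) :
    koopmanMap κ (Linf.indicator E hE) x = ((κ x).real E : ℂ) := by
  change ∫ y, ((E.indicator 1 y : ℝ) : ℂ) ∂(κ x) = _
  rw [integral_complex_ofReal, integral_indicator_one hE]

theorem koopmanMap_kernel (φ : SigmaCPUMap (Linf Y) (Linf X)) : koopmanMap φ.kernel = φ := by
  refine SigmaCPUMap.ext_indicator fun E hE => Linf.ext fun x => ?_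
  have hreal : ((φ (Linf.indicator E hE) x).re : ℂ) = φ (Linf.indicator E hE) x :=
    Linf.isSelfAdjoint_iff.mp (.of_nonneg (map_nonneg φ (Linf.indicator_nonneg E hE))) x
  rw [koopmanMap_indicator_apply, ← hreal, Measure.real]
  refine congrArg _ ((congrArg ENNReal.toReal (φ.measure_apply x hE)).trans ?_)
  exact ENNReal.toReal_ofReal (φ.re_map_indicator_nonneg E hE x)

theorem koopmanMap_injective {κ η : Kernel X Y} [IsMarkovKernel κ] [IsMarkovKernel η]
    (h : koopmanMap κ = koopmanMap η) : κ = η := by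
  refine Kernel.ext fun x => Measure.ext fun E hE => ?_
  have hE' : koopmanMap κ (Linf.indicator E hE) x = koopmanMap η (Linf.indicator E hE) x := by
    rw [h]
  rw [koopmanMap_indicator_apply, koopmanMap_indicator_apply, Complex.ofReal_inj] at hE'
  exact (measureReal_eq_measureReal_iff).mp hE'

instance koopman_full : koopman.{u}.Full where
  map_surjective {X Y} φ :=
    let φ' : SigmaCPUMap (Linf X.unop.obj) (Linf Y.unop.obj) := φ
    ⟨.op ⟨⟨φ'.kernel, inferInstance⟩, inferInstance⟩, koopmanMap_kernel φ'⟩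

instance koopman_faithful : koopman.{u}.Faithful where
  map_injective h :=
    Quiver.Hom.unop_inj (WideSubcategory.hom_ext _ (SFinKer.hom_ext (koopmanMap_injective h)))

end Koopman

/-! ### Pure states and the Gelfand transform on the σ-spectrum -/

section PureStates

variable {A : Type*}

theorem map_eq_zero_of_mem_states [CStarAlgebra A] [PartialOrder A] [StarOrderedRing A]
    {φ : A →ₗ[ℂ] ℂ} (hφ : φ ∈ states A) {a : A} (ha : φ (star a * a) = 0) : φ a = 0 := by
  let f : A →ₚ[ℂ] ℂ := PositiveLinearMap.mk₀ φ hφ.1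
  have hnorm : ‖f.toPreGNS a‖ = 0 := by
    rw [PositiveLinearMap.preGNS_norm_def]
    change √(φ (star a * a)).re = 0
    rw [ha, Complex.zero_re, Real.sqrt_zero]
  have hinner := norm_inner_le_norm (𝕜 := ℂ) (f.toPreGNS 1) (f.toPreGNS a)
  rw [hnorm, mul_zero, PositiveLinearMap.preGNS_inner_def] at hinner
  have hle : ‖φ (star 1 * a)‖ ≤ 0 := hinner
  simpa only [star_one, one_mul, norm_le_zero_iff] using hle

theorem mem_extremePoints_states [CStarAlgebra A] [PartialOrder A] [StarOrderedRing A]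
    (χ : A →⋆ₐ[ℂ] ℂ) : (χ : A →ₐ[ℂ] ℂ).toLinearMap ∈ (states A).extremePoints ℝ := by
  refine mem_extremePoints_iff_left.mpr ⟨⟨fun a ha => map_nonneg χ ha, map_one χ⟩, ?_⟩
  rintro φ hφ ψ hψ ⟨s, t, hs, ht, -, hst⟩
  have hs' : (0 : ℂ) < s := Complex.zero_lt_real.mpr hs
  have ht' : (0 : ℂ) < t := Complex.zero_lt_real.mpr ht
  have hker (a : A) (ha : χ a = 0) : φ a = 0 := by
    have hsum : (s : ℂ) * φ (star a * a) + t * ψ (star a * a) = 0 := by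
      simpa [ha] using LinearMap.congr_fun hst (star a * a)
    have hnonneg := star_mul_self_nonneg a
    rw [add_eq_zero_iff_of_nonneg (mul_nonneg hs'.le (hφ.1 _ hnonneg))
      (mul_nonneg ht'.le (hψ.1 _ hnonneg))] at hsum
    exact map_eq_zero_of_mem_states hφ ((mul_eq_zero.mp hsum.1).resolve_left hs'.ne')
  refine LinearMap.ext fun a => ?_
  have h := hker (a - algebraMap ℂ A (χ a)) (by
    rw [map_sub, AlgHomClass.commutes]; exact sub_self _)
  rw [map_sub, sub_eq_zero, Algebra.algebraMap_eq_smul_one, map_smul, hφ.2] at h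
  simpa using h

variable [CommCStarAlgebra A] [PartialOrder A] [StarOrderedRing A]

theorem inv_smul_comp_mulLeft_mem_states {φ : A →ₗ[ℂ] ℂ} (hφ : φ ∈ states A) {a : A} (ha : 0 ≤ a)
    (hφa : 0 < φ a) : (φ a)⁻¹ • (φ ∘ₗ LinearMap.mulLeft ℂ a) ∈ states A := by
  refine ⟨fun b hb => ?_, ?_⟩
  · exact mul_nonneg (inv_nonneg.mpr hφa.le) (hφ.1 _ ((Commute.all a b).mul_nonneg ha hb))
  · simp [hφa.ne']

/-- The state `φ` is the convex combination, with weights `φ a` and `φ b`, of the states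
`φ (a * ·) / φ a` and `φ (b * ·) / φ b`. -/
theorem map_mul_of_add_eq_one {φ : A →ₗ[ℂ] ℂ} (hφ : φ ∈ (states A).extremePoints ℝ) {a b : A}
    (ha : 0 ≤ a) (hb : 0 ≤ b) (hab : a + b = 1) (hφa : 0 < φ a) (hφb : 0 < φ b) (c : A) :
    φ (a * c) = φ a * φ c := by
  obtain ⟨hst, hext⟩ := mem_extremePoints_iff_left.mp hφ
  have hsum : φ a + φ b = 1 := by rw [← map_add, hab, hst.2]
  have hre (z : ℂ) (hz : 0 < z) : ((z.re : ℝ) : ℂ) = z :=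
    Complex.ext rfl (Complex.lt_def.mp hz).2
  have hextreme := hext _ (inv_smul_comp_mulLeft_mem_states hst ha hφa) _
    (inv_smul_comp_mulLeft_mem_states hst hb hφb)
    ⟨(φ a).re, (φ b).re, (Complex.lt_def.mp hφa).1, (Complex.lt_def.mp hφb).1, ?_, ?_⟩
  · have hc := LinearMap.congr_fun hextreme c
    rw [← hc]
    exact (mul_inv_cancel_left₀ hφa.ne' (φ (a * c))).symm
  · rw [← Complex.add_re, hsum, Complex.one_re]
  · refine LinearMap.ext fun d => ?_
    simp only [LinearMap.add_apply, LinearMap.smul_apply, LinearMap.comp_apply,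
      LinearMap.mulLeft_apply, Complex.real_smul, smul_eq_mul, hre _ hφa, hre _ hφb,
      mul_inv_cancel_left₀ hφa.ne', mul_inv_cancel_left₀ hφb.ne']
    rw [← map_add, ← add_mul, hab, one_mul]

theorem map_mul_of_nonneg_of_mem_extremePoints_states {φ : A →ₗ[ℂ] ℂ}
    (hφ : φ ∈ (states A).extremePoints ℝ) {a : A} (ha : 0 ≤ a) (c : A) :
    φ (a * c) = φ a * φ c := by
  obtain ⟨hpos, hone⟩ := hφ.1
  set s : ℂ := ‖a‖ + 2
  have hs : 0 < s := add_pos_of_nonneg_of_pos (Complex.zero_le_real.mpr (norm_nonneg a)) two_pos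
  have hs' : 0 < s⁻¹ := inv_pos.mpr hs
  have hb : 0 ≤ algebraMap ℝ A ‖a‖ - a :=
    sub_nonneg.mpr (IsSelfAdjoint.of_nonneg ha).le_algebraMap_norm_self
  have hsum : s⁻¹ • (1 + a) + s⁻¹ • (1 + (algebraMap ℝ A ‖a‖ - a)) = 1 := by
    have hadd : (1 + a) + (1 + (algebraMap ℝ A ‖a‖ - a)) = algebraMap ℂ A s := by
      rw [map_add, ← Complex.coe_algebraMap, ← IsScalarTower.algebraMap_apply, map_ofNat,
        ← one_add_one_eq_two]
      abel
    rw [← smul_add, hadd, Algebra.algebraMap_eq_smul_one, inv_smul_smul₀ hs.ne']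
  have hφ_pos {b : A} (hb : 0 ≤ b) : 0 < φ (s⁻¹ • (1 + b)) := by
    rw [map_smul, map_add, hone]
    exact mul_pos hs' (add_pos_of_pos_of_nonneg one_pos (hpos _ hb))
  have hmul := map_mul_of_add_eq_one hφ (smul_nonneg hs'.le (add_nonneg zero_le_one ha))
    (smul_nonneg hs'.le (add_nonneg zero_le_one hb)) hsum (hφ_pos ha) (hφ_pos hb) c
  rw [smul_mul_assoc, map_smul, map_smul, smul_eq_mul, smul_eq_mul, mul_assoc,
    mul_right_inj' hs'.ne', add_mul, one_mul, map_add, map_add, hone, add_mul, one_mul] at hmul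
  exact add_left_cancel hmul

theorem map_mul_of_mem_extremePoints_states {φ : A →ₗ[ℂ] ℂ}
    (hφ : φ ∈ (states A).extremePoints ℝ) (a b : A) : φ (a * b) = φ a * φ b := by
  have h : (LinearMap.mul ℂ A).compr₂ φ = (LinearMap.mul ℂ ℂ).compl₁₂ φ φ :=
    LinearMap.ext_on CStarAlgebra.span_nonneg fun a ha => LinearMap.ext fun b =>
      map_mul_of_nonneg_of_mem_extremePoints_states hφ ha b
  exact LinearMap.congr_fun₂ h a b

/-- A pure σ-state of a commutative algebra, as a point of the Gelfand σ-spectrum. -/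
def SigmaSpectrum.ofPureSigmaState {φ : A →ₗ[ℂ] ℂ} (hφ : φ ∈ pureSigmaStates A) :
    SigmaSpectrum A :=
  ⟨{ AlgHom.ofLinearMap φ hφ.1.1.2 (map_mul_of_mem_extremePoints_states hφ.1) with
    map_star' := map_star (PositiveLinearMap.mk₀ φ hφ.1.1.1) }, hφ.2⟩

theorem isPurelySigmaRepresentable_iff : IsPurelySigmaRepresentable A ↔
    ∀ x : A, 0 ≤ x → (∀ χ : SigmaSpectrum A, χ.1 x = 0) → x = 0 :=
  forall₂_congr fun _ _ =>
    ⟨fun h hx => h fun _ hφ => hx (.ofPureSigmaState hφ),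
      fun h hx => h fun χ => hx _ ⟨mem_extremePoints_states χ.1, χ.2⟩⟩

end PureStates

namespace Linf

variable {X : Type*} [MeasurableSpace X]

theorem isSigmaNormal_eval (x : X) : IsSigmaNormal (eval x) := fun _ _ h =>
  isLUB_of_tendsto_atTop (fun _ _ hij => h.monotone hij x) (tendsto_of_increasesTo h x)

/-- Evaluation at a point, as a point of the Gelfand σ-spectrum. -/
def evalSpec (x : X) : SigmaSpectrum (Linf X) :=
  ⟨eval x, isSigmaNormal_eval x⟩

theorem isPurelySigmaRepresentable : IsPurelySigmaRepresentable (Linf X) :=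
  isPurelySigmaRepresentable_iff.mpr fun _ _ h => Linf.ext fun x => h (evalSpec x)

end Linf

section StarAlgHom

variable {A B : Type*} [CStarAlgebra A] [PartialOrder A] [StarOrderedRing A]
  [CStarAlgebra B] [PartialOrder B] [StarOrderedRing B]

theorem norm_le_of_mem_Icc {a b c : A} (hb : b ∈ Set.Icc a c) : ‖b‖ ≤ ‖c - a‖ + ‖a‖ := calc
  ‖b‖ = ‖(b - a) + a‖ := by rw [sub_add_cancel]
  _ ≤ ‖b - a‖ + ‖a‖ := norm_add_le _ _
  _ ≤ ‖c - a‖ + ‖a‖ := by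
    gcongr
    exact CStarAlgebra.norm_le_norm_of_nonneg_of_le (sub_nonneg.mpr hb.1)
      (sub_le_sub_right hb.2 a)

theorem IncreasesTo.norm_le {a : ℕ → A} {s : A} (h : IncreasesTo a s) (n : ℕ) :
    ‖a n‖ ≤ ‖s - a 0‖ + ‖a 0‖ :=
  norm_le_of_mem_Icc ⟨h.monotone n.zero_le, h.isLUB.1 ⟨n, rfl⟩⟩

theorem le_of_starAlgHom_map_le {φ : A →⋆ₐ[ℂ] B} (hφ : Function.Injective φ) {a b : A}
    (ha : IsSelfAdjoint a) (hb : IsSelfAdjoint b) (h : φ a ≤ φ b) : a ≤ b := by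
  rw [← sub_nonneg, ← map_sub] at h
  rw [← sub_nonneg]
  exact Linf.nonneg_of_forall_map (ι := Unit)
    (fun _ => NonUnitalStarAlgHomClass.toNonUnitalStarAlgHom φ)
    (fun c hc => (map_eq_zero_iff φ hφ).mp (hc ())) (hb.sub ha) fun _ => h

theorem isSigmaClosed_range (hA : IsSigmaComplete A) {φ : A →⋆ₐ[ℂ] B}
    (hinj : Function.Injective φ) (hφ : IsSigmaNormal φ) :
    IsSigmaClosed (φ : A →ₐ[ℂ] B).toLinearMap.range := by
  intro b s hb h
  choose a ha using hb
  replace ha (n : ℕ) : φ (a n) = b n := ha n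
  have hsa (n : ℕ) : IsSelfAdjoint (a n) := hinj (by
    rw [map_star, ha]; exact (h.isSelfAdjoint n).star_eq)
  have hmono : Monotone a := fun i j hij =>
    le_of_starAlgHom_map_le hinj (hsa i) (hsa j) (by rw [ha, ha]; exact h.monotone hij)
  obtain ⟨t, ht⟩ := hA a hsa hmono ⟨_, fun n => by
    rw [← NonUnitalStarAlgHom.norm_map _ hinj, ha]; exact h.norm_le n⟩
  have hlub := hφ a t ht
  simp_rw [ha] at hlub
  exact ⟨t, hlub.unique h.isLUB⟩

/-- A star isomorphism as a σ-cpu map. -/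
def SigmaCPUMap.ofStarAlgEquiv (e : A ≃⋆ₐ[ℂ] B) : SigmaCPUMap A B where
  toCompletelyPositiveMap := CompletelyPositiveMapClass.toCompletelyPositiveLinearMap e
  map_one' := map_one e
  isSigmaNormal' a s h := by
    have hlub := (OrderIsoClass.toOrderIso e).isLUB_image'.mpr h.isLUB
    rwa [← Set.range_comp] at hlub

/-- The action of star isomorphisms on the Gelfand σ-spectrum. -/
def SigmaSpectrum.comap (e : A ≃⋆ₐ[ℂ] B) (χ : SigmaSpectrum B) : SigmaSpectrum A :=
  ⟨χ.1.comp (e : A →⋆ₐ[ℂ] B),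
    fun _ _ h => χ.2 _ _ ((SigmaCPUMap.ofStarAlgEquiv e).increasesTo h)⟩

end StarAlgHom

section SigmaGelfand

namespace SigmaSpectrum

variable {A : Type*} [CStarAlgebra A] [PartialOrder A]

@[ext] theorem ext {χ ψ : SigmaSpectrum A} (h : ∀ a, χ.1 a = ψ.1 a) : χ = ψ :=
  Subtype.ext (DFunLike.ext _ _ h)

theorem measurable_apply (a : A) : Measurable fun χ : SigmaSpectrum A => χ.1 a :=
  Measurable.of_comap_le (le_iSup (fun a : A => (borel ℂ).comap fun χ : SigmaSpectrum A => χ.1 a) a)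

theorem measurable_of_forall {Y : Type*} [MeasurableSpace Y] {g : Y → SigmaSpectrum A}
    (h : ∀ a, Measurable fun y => (g y).1 a) : Measurable g := by
  refine measurable_iff_comap_le.mpr (MeasurableSpace.comap_iSup.trans_le (iSup_le fun a => ?_))
  rw [MeasurableSpace.comap_comp]
  exact (h a).comap_le

end SigmaSpectrum

/-- The Gelfand transform of a C⋆-algebra, restricted to its σ-spectrum. -/
def sigmaGelfand (A : Type*) [CStarAlgebra A] [PartialOrder A] :
    A →⋆ₐ[ℂ] Linf (SigmaSpectrum A) where
  toFun a := Linf.mk (fun χ => χ.1 a) (SigmaSpectrum.measurable_apply a) ‖a‖ fun χ =>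
    NonUnitalStarAlgHom.norm_apply_le χ.1 a
  map_one' := Linf.ext fun χ => map_one χ.1
  map_mul' a b := Linf.ext fun χ => map_mul χ.1 a b
  map_zero' := Linf.ext fun χ => map_zero χ.1
  map_add' a b := Linf.ext fun χ => map_add χ.1 a b
  commutes' r := Linf.ext fun χ => AlgHomClass.commutes χ.1 r
  map_star' a := Linf.ext fun χ => map_star χ.1 a

theorem sigmaGelfand_apply {A : Type*} [CStarAlgebra A] [PartialOrder A] (a : A)
    (χ : SigmaSpectrum A) : sigmaGelfand A a χ = χ.1 a := rfl

theorem isSigmaNormal_sigmaGelfand (A : Type*) [CStarAlgebra A] [PartialOrder A] :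
    IsSigmaNormal (sigmaGelfand A) := by
  refine fun a s h => ⟨?_, fun g hg χ => (χ.2 a s h).2 ?_⟩
  · rintro _ ⟨n, rfl⟩ χ
    exact (χ.2 a s h).1 ⟨n, rfl⟩
  · rintro _ ⟨n, rfl⟩
    exact hg ⟨n, rfl⟩ χ

variable {A : Type*} [CommCStarAlgebra A] [PartialOrder A] [StarOrderedRing A]

theorem sigmaGelfand_injective (hA : IsPurelySigmaRepresentable A) :
    Function.Injective (sigmaGelfand A) := by
  refine (injective_iff_map_eq_zero _).mpr fun a ha => (CStarRing.star_mul_self_eq_zero_iff a).mp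
    (isPurelySigmaRepresentable_iff.mp hA _ (star_mul_self_nonneg a) fun χ => ?_)
  rw [map_mul, ← sigmaGelfand_apply a, ha, Linf.zero_apply, mul_zero]

theorem sigmaGelfand_surjective (hA : IsPurelySigmaRepresentable A) (hσ : IsSigmaComplete A) :
    Function.Surjective (sigmaGelfand A) := by
  refine fun f => Linf.mem_of_generating (isSigmaClosed_range hσ (sigmaGelfand_injective hA)
    (isSigmaNormal_sigmaGelfand A)) ⟨1, map_one (sigmaGelfand A)⟩
    (T := Set.range (sigmaGelfand A)) ?_ ?_ ?_ ?_ f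
  · rintro _ ⟨a, rfl⟩
    exact ⟨a, rfl⟩
  · rintro _ ⟨a, rfl⟩ _ ⟨b, rfl⟩
    exact ⟨a * b, map_mul _ a b⟩
  · rintro _ ⟨a, rfl⟩ g
    refine ⟨_, ⟨cfc (g : ℂ → ℂ) a, rfl⟩, fun χ => ?_⟩
    rw [sigmaGelfand_apply, sigmaGelfand_apply,
      StarAlgHomClass.map_cfc (S := ℂ) χ.1 (g : ℂ → ℂ) a (hφ := map_continuous χ.1)]
    exact cfc_algebraMap (A := ℂ) (χ.1 a) (g : ℂ → ℂ)
  · exact iSup_le fun a => le_iSup₂_of_le (sigmaGelfand A a) ⟨a, rfl⟩ le_rfl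

/-- A commutative purely σ-representable σC⋆-algebra as the algebra of bounded measurable functions
on its σ-spectrum. -/
def sigmaGelfandEquiv (hA : IsPurelySigmaRepresentable A) (hσ : IsSigmaComplete A) :
    A ≃⋆ₐ[ℂ] Linf (SigmaSpectrum A) :=
  StarAlgEquiv.ofBijective (sigmaGelfand A)
    ⟨sigmaGelfand_injective hA, sigmaGelfand_surjective hA hσ⟩

theorem IsPurelySigmaRepresentable.of_equiv {B : Type*} [CommCStarAlgebra B] [PartialOrder B]
    [StarOrderedRing B] (hA : IsPurelySigmaRepresentable A) (e : B ≃⋆ₐ[ℂ] A) :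
    IsPurelySigmaRepresentable B :=
  isPurelySigmaRepresentable_iff.mpr fun x hx h => (map_eq_zero_iff e e.injective).mp
    (isPurelySigmaRepresentable_iff.mp hA (e x) (map_nonneg e hx) fun χ => h (χ.comap e))

end SigmaGelfand

section Duality

/-- Star isomorphic algebras are isomorphic in the category of σ-cpu maps. -/
def CommSigmaCStar.isoOfStarAlgEquiv {A B : CommSigmaCStar.{u}} (e : A ≃⋆ₐ[ℂ] B) : A ≅ B where
  hom := SigmaCPUMap.ofStarAlgEquiv e
  inv := SigmaCPUMap.ofStarAlgEquiv e.symm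
  hom_inv_id := SigmaCPUMap.ext fun a => e.symm_apply_apply a
  inv_hom_id := SigmaCPUMap.ext fun a => e.apply_symm_apply a

/-- The Gelfand transform on the σ-spectrum, as an isomorphism in the category of σ-cpu maps. -/
def gelfandIso (A : CommSigmaCStar.{u}) (hA : CommSigmaCStar.isPure A) :
    A ≅ koopman.obj (.op (specStoch A)) :=
  CommSigmaCStar.isoOfStarAlgEquiv (B := koopman.obj (.op (specStoch A)))
    (sigmaGelfandEquiv hA A.isSigmaComplete)

/-- A σ-cpu map between purely σ-representable algebras, transported to the Koopman algebras of the
σ-spectra. -/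
def gelfandConj {A B : CommSigmaCStar.isPure.{u}.FullSubcategory} (φ : A ⟶ B) :
    koopman.obj (.op (specStoch A.obj)) ⟶ koopman.obj (.op (specStoch B.obj)) :=
  (gelfandIso A.obj A.property).inv ≫ φ.hom ≫ (gelfandIso B.obj B.property).hom

/-- The Gelfand σ-spectrum acts on a σ-cpu map through the Markov kernel whose Koopman operator is
its conjugate by the Gelfand transforms. -/
def specAction : SpecAction.{u} where
  map φ := (koopman.preimage (gelfandConj φ)).unop
  map_id A := by
    refine Quiver.Hom.op_inj (koopman.map_injective ?_)
    rw [Quiver.Hom.op_unop, koopman.map_preimage, op_id, koopman.map_id, gelfandConj,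
      ObjectProperty.FullSubcategory.id_hom, Category.id_comp, Iso.inv_hom_id]
  map_comp φ ψ := by
    refine Quiver.Hom.op_inj (koopman.map_injective ?_)
    simp only [op_comp, koopman.map_comp, Quiver.Hom.op_unop, koopman.map_preimage, gelfandConj,
      ObjectProperty.FullSubcategory.comp_hom, Category.assoc, Iso.hom_inv_id_assoc]
  integral_map {A B} φ ψ a := by
    have h := (Iso.eq_inv_comp _).mp (koopman.map_preimage (gelfandConj φ))
    exact congrArg (fun f : SigmaCPUMap A.obj (Linf (SigmaSpectrum B.obj)) => f a ψ) h

theorem koopman_map_specAction_map {A B : CommSigmaCStar.isPure.{u}.FullSubcategory}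
    (φ : A ⟶ B) : koopman.map (specAction.map φ).op ≫ (gelfandIso B.obj B.property).inv =
      (gelfandIso A.obj A.property).inv ≫ φ.hom := by
  have h : koopman.map (specAction.map φ).op = gelfandConj φ := koopman.map_preimage _
  rw [h, gelfandConj, Category.assoc, Category.assoc, Iso.hom_inv_id, Category.comp_id]

theorem exists_equivalence_of_comp_iso {C D : Type*} [Category* C] [Category* D] (F : C ⥤ D)
    [F.Full] [F.Faithful] (G : D ⥤ C) (ε : G ⋙ F ≅ 𝟭 D) :
    ∃ e : C ≌ D, e.functor = F ∧ e.inverse = G := by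
  let η : 𝟭 C ≅ F ⋙ G := NatIso.ofComponents (fun X => F.preimageIso (ε.app (F.obj X)).symm)
    fun f => F.map_injective (by simpa using ε.inv.naturality (F.map f))
  exact ⟨CategoryTheory.Equivalence.mk F G η ε, rfl, rfl⟩

theorem isPure_koopman (X : Stoch.{u}ᵒᵖ) : CommSigmaCStar.isPure (koopman.obj X) :=
  Linf.isPurelySigmaRepresentable

theorem exists_duality : ∃ e : Stoch.{u}ᵒᵖ ≌ CommSigmaCStar.isPure.{u}.FullSubcategory,
    e.functor = CommSigmaCStar.isPure.lift koopman isPure_koopman ∧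
      e.inverse = specAction.functor.rightOp :=
  exists_equivalence_of_comp_iso _ _ (NatIso.ofComponents
    (fun A => CommSigmaCStar.isPure.isoMk (gelfandIso A.obj A.property).symm)
    fun φ => InducedCategory.hom_ext (koopman_map_specAction_map φ))

theorem restrictsToDuality (P : ObjectProperty Stoch.{u}) (Q : ObjectProperty CommSigmaCStar.{u})
    (hQ : Q ≤ CommSigmaCStar.isPure) (hL : ∀ X : Stoch.{u}, P X → Q (koopman.obj (.op X)))
    (hS : ∀ A : CommSigmaCStar.{u}, Q A → P (specStoch A)) :
    RestrictsToDuality P Q specAction :=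
  ⟨hQ, fun X => hL _ X.unop.property, fun A => hS _ A.unop.property,
    exists_equivalence_of_comp_iso _ _ (NatIso.ofComponents
      (fun A => Q.isoMk (gelfandIso A.obj (hQ _ A.property)).symm)
      fun φ => InducedCategory.hom_ext
        (koopman_map_specAction_map ((ObjectProperty.ιOfLE hQ).map φ)))⟩

end Duality

/-! ### Monotone limits of operators and the universal representation -/

section Operators

open scoped InnerProductSpace

variable {H : Type*} [NormedAddCommGroup H] [InnerProductSpace ℂ H]

theorem operator_le_iff {S T : H →L[ℂ] H} : S ≤ T ↔ ∀ ξ, ⟪ξ, S ξ⟫_ℂ ≤ ⟪ξ, T ξ⟫_ℂ := by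
  rw [ContinuousLinearMap.le_def]
  refine ⟨fun h ξ => ?_, fun h => ?_⟩
  · simpa [inner_sub_right] using h.inner_nonneg_right ξ
  · refine (ContinuousLinearMap.isPositive_iff_complex _).mpr fun ξ => ?_
    have hnonneg : 0 ≤ ⟪(T - S) ξ, ξ⟫_ℂ := by
      rw [← inner_conj_symm, sub_apply, inner_sub_right]
      exact star_nonneg_iff.mpr (sub_nonneg.mpr (h ξ))
    exact ⟨Complex.ext rfl (Complex.le_def.mp hnonneg).2, (Complex.le_def.mp hnonneg).1⟩

theorem operator_ext {S T : H →L[ℂ] H} (h : ∀ ξ, ⟪ξ, S ξ⟫_ℂ = ⟪ξ, T ξ⟫_ℂ) : S = T :=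
  le_antisymm (operator_le_iff.mpr fun ξ => (h ξ).le) (operator_le_iff.mpr fun ξ => (h ξ).ge)

variable [CompleteSpace H]

theorem norm_operator_apply_sq_le {T : H →L[ℂ] H} (hT : 0 ≤ T) (ξ : H) :
    ‖T ξ‖ ^ 2 ≤ ‖T‖ * (⟪ξ, T ξ⟫_ℂ).re := by
  obtain ⟨S, rfl⟩ := CStarAlgebra.nonneg_iff_eq_star_mul_self.mp hT
  have hinner : ⟪ξ, (star S * S) ξ⟫_ℂ = (‖S ξ‖ : ℂ) ^ 2 :=
    (ContinuousLinearMap.adjoint_inner_right S ξ (S ξ)).trans (inner_self_eq_norm_sq_to_K _)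
  rw [hinner, CStarRing.norm_star_mul_self, ← Complex.ofReal_pow, Complex.ofReal_re]
  calc ‖(star S * S) ξ‖ ^ 2 ≤ (‖S‖ * ‖S ξ‖) ^ 2 := by
        gcongr
        exact (star S).le_of_opNorm_le (norm_star S).le (S ξ)
    _ = ‖S‖ * ‖S‖ * ‖S ξ‖ ^ 2 := by ring

theorem cauchySeq_operator_apply {a : ℕ → H →L[ℂ] H} (hm : Monotone a) {C : ℝ}
    (hC : ∀ n, ‖a n‖ ≤ C) (ξ : H) : CauchySeq fun n => a n ξ := by
  have hmono : Monotone fun n => (⟪ξ, a n ξ⟫_ℂ).re := fun i j hij =>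
    (Complex.le_def.mp (operator_le_iff.mp (hm hij) ξ)).1
  have hbdd : BddAbove (Set.range fun n => (⟪ξ, a n ξ⟫_ℂ).re) := by
    refine ⟨‖ξ‖ * (C * ‖ξ‖), ?_⟩
    rintro _ ⟨n, rfl⟩
    refine (Complex.re_le_norm _).trans ((norm_inner_le_norm _ _).trans ?_)
    gcongr
    exact (a n).le_of_opNorm_le (hC n) ξ
  have hlim := tendsto_atTop_ciSup hmono hbdd
  set s := ⨆ n, (⟪ξ, a n ξ⟫_ℂ).re
  refine cauchySeq_of_le_tendsto_0' (fun n => √((C + C) * (s - (⟪ξ, a n ξ⟫_ℂ).re)))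
    (fun i j hij => ?_) ?_
  · rw [dist_comm, dist_eq_norm, ← sub_apply]
    refine Real.le_sqrt_of_sq_le ((norm_operator_apply_sq_le (sub_nonneg.mpr (hm hij)) ξ).trans ?_)
    rw [sub_apply, inner_sub_right, Complex.sub_re]
    refine mul_le_mul ((norm_sub_le _ _).trans (add_le_add (hC j) (hC i)))
      (sub_le_sub_right (hmono.ge_of_tendsto hlim j) _) (sub_nonneg.mpr (hmono hij)) ?_
    exact (norm_nonneg _).trans ((norm_add_le (a j) (a i)).trans (add_le_add (hC j) (hC i)))
  · simpa using (((tendsto_const_nhds (x := s)).sub hlim).const_mul (C + C)).sqrt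

theorem exists_tendsto_operator_apply {a : ℕ → H →L[ℂ] H} (hm : Monotone a) {C : ℝ}
    (hC : ∀ n, ‖a n‖ ≤ C) :
    ∃ s : H →L[ℂ] H, ∀ ξ, Tendsto (fun n => a n ξ) atTop (𝓝 (s ξ)) := by
  choose f hf using fun ξ => cauchySeq_tendsto_of_complete (cauchySeq_operator_apply hm hC ξ)
  exact ⟨continuousLinearMapOfTendsto a (f := f) (tendsto_pi_nhds.mpr hf), hf⟩

theorem increasesTo_of_tendsto_inner {a : ℕ → H →L[ℂ] H} {s : H →L[ℂ] H}
    (hsa : ∀ n, IsSelfAdjoint (a n)) (hm : Monotone a)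
    (h : ∀ ξ, Tendsto (fun n => ⟪ξ, a n ξ⟫_ℂ) atTop (𝓝 ⟪ξ, s ξ⟫_ℂ)) : IncreasesTo a s where
  isSelfAdjoint := hsa
  monotone := hm
  isLUB := by
    refine ⟨?_, fun b hb => operator_le_iff.mpr fun ξ =>
      le_of_tendsto' (h ξ) fun n => operator_le_iff.mp (hb ⟨n, rfl⟩) ξ⟩
    rintro _ ⟨n, rfl⟩
    exact operator_le_iff.mpr fun ξ =>
      Monotone.ge_of_tendsto (fun i j hij => operator_le_iff.mp (hm hij) ξ) (h ξ) n

theorem IncreasesTo.tendsto_apply {a : ℕ → H →L[ℂ] H} {s : H →L[ℂ] H} (h : IncreasesTo a s)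
    (ξ : H) : Tendsto (fun n => a n ξ) atTop (𝓝 (s ξ)) := by
  obtain ⟨t, ht⟩ := exists_tendsto_operator_apply h.monotone h.norm_le
  have hlub := increasesTo_of_tendsto_inner h.isSelfAdjoint h.monotone
    (s := t) fun ξ => tendsto_const_nhds.inner (ht ξ)
  rw [h.isLUB.unique hlub.isLUB]
  exact ht ξ

end Operators

section UniversalRepresentation

open scoped InnerProductSpace

variable {A : Type*} [CStarAlgebra A] [PartialOrder A] [StarOrderedRing A]

theorem exists_positiveLinearMap_pos {a : A} (ha : 0 ≤ a) (hne : a ≠ 0) :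
    ∃ φ : A →ₚ[ℂ] ℂ, 0 < φ a := by
  let cone : ProperCone ℝ A :=
    { toSubmodule := PointedCone.positive ℝ A
      isClosed' := CStarAlgebra.isClosed_nonneg }
  obtain ⟨f, hf, hfa⟩ := cone.hyperplane_separation_point (x₀ := -a)
    fun h => hne (le_antisymm (neg_nonneg.mp h) ha)
  -- Composing with the real part makes `φ` real on self-adjoint elements.
  let φ : A →ₗ[ℂ] ℂ :=
    Module.Dual.extendRCLike (f.toLinearMap ∘ₗ (selfAdjoint.submodule ℝ A).subtype ∘ₗ realPart)
  have hφ (b : A) (hb : IsSelfAdjoint b) : φ b = f b := by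
    refine (Module.Dual.extendRCLike_apply _ b).trans ?_
    change (f (realPart b : A) : ℂ) - Complex.I * (f (realPart (Complex.I • b) : A) : ℂ) = f b
    rw [realPart_I_smul, hb.imaginaryPart, hb.coe_realPart]
    simp
  refine ⟨PositiveLinearMap.mk₀ φ fun b hb => ?_, ?_⟩
  · rw [hφ b (.of_nonneg hb)]
    exact Complex.zero_le_real.mpr (hf b hb)
  · refine (Complex.zero_lt_real.mpr ?_).trans_eq (hφ a (.of_nonneg ha)).symm
    rwa [map_neg, neg_lt_zero] at hfa

theorem exists_state_ne_zero {a : A} (ha : 0 ≤ a) (hne : a ≠ 0) :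
    ∃ φ : A →ₚ[ℂ] ℂ, φ 1 = 1 ∧ φ a ≠ 0 := by
  obtain ⟨φ, hφ⟩ := exists_positiveLinearMap_pos ha hne
  have hle : φ a ≤ ‖a‖ * φ 1 := by
    have h := OrderHomClass.mono φ (IsSelfAdjoint.of_nonneg ha).le_algebraMap_norm_self
    rwa [Algebra.algebraMap_eq_smul_one, ← Complex.coe_smul, map_smul, smul_eq_mul] at h
  have hone : φ 1 ≠ 0 := by
    rintro hzero
    rw [hzero, mul_zero] at hle
    exact hφ.not_ge hle
  have hinv : 0 ≤ (φ 1)⁻¹ := inv_nonneg.mpr (map_nonneg φ zero_le_one)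
  exact ⟨PositiveLinearMap.mk₀ ((φ 1)⁻¹ • φ.toLinearMap) fun b hb =>
    mul_nonneg hinv (map_nonneg φ hb), inv_mul_cancel₀ hone,
    mul_ne_zero (inv_ne_zero hone) hφ.ne'⟩

theorem exists_inner_universalRep (φ : A →ₚ[ℂ] ℂ) (hφ : φ 1 = 1) :
    ∃ ξ : UnivHilbert A, ∀ a, ⟪ξ, universalRep A a ξ⟫_ℂ = φ a := by
  classical
  let i : {φ : A →ₚ[ℂ] ℂ // φ 1 = 1} := ⟨φ, hφ⟩
  refine ⟨lp.single 2 i ((φ.toPreGNS 1 : φ.PreGNS) : φ.GNS), fun a => ?_⟩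
  rw [lp.inner_single_left]
  change ⟪_, universalRepFun a _ i⟫_ℂ = _
  rw [universalRepFun_apply, lp.single_apply_self]
  change ⟪((φ.toPreGNS 1 : φ.PreGNS) : φ.GNS), φ.gnsNonUnitalStarAlgHom a _⟫_ℂ = _
  rw [PositiveLinearMap.gnsNonUnitalStarAlgHom_apply_coe, UniformSpace.Completion.inner_coe,
    PositiveLinearMap.preGNS_inner_def]
  simp

theorem universalRep_injective : Function.Injective (universalRep A) := by
  refine (injective_iff_map_eq_zero _).mpr fun a ha => ?_
  by_contra hne
  obtain ⟨φ, hφ, hφa⟩ := exists_state_ne_zero (star_mul_self_nonneg a)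
    (mt (CStarRing.star_mul_self_eq_zero_iff a).mp hne)
  obtain ⟨ξ, hξ⟩ := exists_inner_universalRep φ hφ
  apply hφa
  rw [← hξ, map_mul, ha, mul_zero, zero_apply, inner_zero_right]

end UniversalRepresentation

/-! ### Baire measures -/

/-- The σ-algebra of a topological space is its Baire σ-algebra, the smallest one making all
continuous real functions measurable. -/
class BaireMeasurable (K : Type*) [TopologicalSpace K] [m : MeasurableSpace K] : Prop where
  eq_iSup : m = ⨆ f : C(K, ℝ), (borel ℝ).comap f

section Baire

variable {K : Type*} [TopologicalSpace K] [m : MeasurableSpace K]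

theorem BaireMeasurable.measurable_real [BaireMeasurable K] (f : C(K, ℝ)) : Measurable f := by
  refine Measurable.of_comap_le ?_
  rw [BaireMeasurable.eq_iSup (K := K)]
  exact le_iSup (fun f : C(K, ℝ) => (borel ℝ).comap f) f

theorem BaireMeasurable.measurable_of_forall [BaireMeasurable K] {Y : Type*} [MeasurableSpace Y]
    {g : Y → K} (h : ∀ f : C(K, ℝ), Measurable (f ∘ g)) : Measurable g := by
  refine measurable_iff_comap_le.mpr ?_
  rw [BaireMeasurable.eq_iSup (K := K), MeasurableSpace.comap_iSup]
  refine iSup_le fun f => ?_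
  rw [MeasurableSpace.comap_comp]
  exact (h f).comap_le

theorem BaireMeasurable.measurable_of_continuous [BaireMeasurable K] {Y : Type*}
    [TopologicalSpace Y] [PerfectlyNormalSpace Y] [MeasurableSpace Y] [BorelSpace Y] {f : K → Y}
    (hf : Continuous f) : Measurable f := by
  refine measurable_of_isClosed fun F hF => ?_
  obtain ⟨g, hg, -⟩ := perfectlyNormalSpace_iff_forall_isClosed_preimage_zero.mp ‹_› F hF
  rw [hg, ← Set.preimage_comp]
  exact measurable_real (g.comp ⟨f, hf⟩) (measurableSet_singleton 0)

theorem BaireMeasurable.le_borel [BaireMeasurable K] : m ≤ borel K := by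
  rw [BaireMeasurable.eq_iSup (K := K)]
  exact iSup_le fun f => f.continuous.borel_measurable.comap_le

theorem borel_eq_iSup_comap {K : Type*} [TopologicalSpace K] [PerfectlyNormalSpace K] :
    borel K = ⨆ f : C(K, ℝ), (borel ℝ).comap f := by
  let baire : MeasurableSpace K := ⨆ f : C(K, ℝ), (borel ℝ).comap f
  have : BaireMeasurable K := ⟨rfl⟩
  have hid : Measurable[baire, borel K] id :=
    @BaireMeasurable.measurable_of_continuous K _ baire this K _ _ (borel K)
      (@BorelSpace.mk K _ (borel K) rfl) id continuous_id
  exact le_antisymm (MeasurableSpace.comap_id.symm.trans_le hid.comap_le) BaireMeasurable.le_borel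

theorem baireMeasurable_iff_borelSpace [PerfectlyNormalSpace K] :
    BaireMeasurable K ↔ BorelSpace K :=
  ⟨fun h => ⟨h.eq_iSup.trans borel_eq_iSup_comap.symm⟩,
    fun h => ⟨h.measurable_eq.trans borel_eq_iSup_comap⟩⟩

namespace Linf

variable [BaireMeasurable K] [CompactSpace K]

/-- Continuous functions as bounded Baire functions. -/
def ofContinuous : C(K, ℂ) →⋆ₐ[ℂ] Linf K where
  toFun f := mk f (BaireMeasurable.measurable_of_continuous f.continuous) ‖f‖ f.norm_coe_le_norm
  map_one' := rfl
  map_mul' _ _ := rfl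
  map_zero' := rfl
  map_add' _ _ := rfl
  commutes' _ := rfl
  map_star' _ := rfl

theorem mem_of_forall_ofContinuous_mem {V : Submodule ℂ (Linf K)} (hV : IsSigmaClosed V)
    (h : ∀ f : C(K, ℂ), ofContinuous f ∈ V) (f : Linf K) : f ∈ V := by
  refine mem_of_generating hV (map_one (ofContinuous (K := K)) ▸ h 1)
    (T := Set.range ofContinuous) ?_ ?_ ?_ ?_ f
  · rintro _ ⟨f, rfl⟩
    exact h f
  · rintro _ ⟨f, rfl⟩ _ ⟨g, rfl⟩
    exact ⟨f * g, rfl⟩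
  · rintro _ ⟨f, rfl⟩ g
    exact ⟨_, ⟨g.comp f, rfl⟩, fun x => rfl⟩
  · refine (BaireMeasurable.eq_iSup (K := K)).le.trans (iSup_le fun f => ?_)
    refine le_iSup₂_of_le (ofContinuous ⟨fun x => (f x : ℂ), by fun_prop⟩) ⟨_, rfl⟩ ?_
    calc (borel ℝ).comap f = ((borel ℝ).comap Complex.re).comap (fun x => (f x : ℂ)) := by
          rw [MeasurableSpace.comap_comp]; rfl
      _ ≤ _ := MeasurableSpace.comap_mono Complex.measurable_re.comap_le

end Linf

theorem exists_integral_eq_of_borelSpace [BorelSpace K] [CompactSpace K] [T2Space K]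
    (Λ : C(K, ℝ) →ₚ[ℝ] ℝ) :
    ∃ μ : Measure K, IsFiniteMeasure μ ∧ ∀ f : C(K, ℝ), ∫ x, f x ∂μ = Λ f := by
  let Λc : CompactlySupportedContinuousMap K ℝ →ₚ[ℝ] ℝ := PositiveLinearMap.mk₀
    { toFun := fun f => Λ f.toContinuousMap
      map_add' := fun f g => map_add Λ f.toContinuousMap g.toContinuousMap
      map_smul' := fun c f => map_smul Λ c f.toContinuousMap }
    fun f hf => map_nonneg Λ (a := f.toContinuousMap) hf
  exact ⟨RealRMK.rieszMeasure Λc, inferInstance, fun f =>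
    RealRMK.integral_rieszMeasure Λc ⟨f, HasCompactSupport.of_compactSpace _⟩⟩

theorem BaireMeasurable.exists_integral_real_eq [BaireMeasurable K] [CompactSpace K] [T2Space K]
    (Λ : C(K, ℝ) →ₚ[ℝ] ℝ) :
    ∃ μ : Measure K, IsFiniteMeasure μ ∧ ∀ f : C(K, ℝ), ∫ x, f x ∂μ = Λ f := by
  obtain ⟨ν, _, hν⟩ := @exists_integral_eq_of_borelSpace K _ (borel K)
    (@BorelSpace.mk K _ (borel K) rfl) _ _ Λ
  exact ⟨ν.trim le_borel, isFiniteMeasure_trim le_borel, fun f =>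
    (integral_trim le_borel (measurable_real f).stronglyMeasurable).symm.trans (hν f)⟩

theorem BaireMeasurable.exists_integral_eq [BaireMeasurable K] [CompactSpace K] [T2Space K]
    (Λ : C(K, ℂ) →ₚ[ℂ] ℂ) :
    ∃ μ : Measure K, IsFiniteMeasure μ ∧ ∀ f : C(K, ℂ), ∫ x, f x ∂μ = Λ f := by
  let ofReal : C(K, ℝ) →L[ℝ] C(K, ℂ) := Complex.ofRealCLM.compLeftContinuous ℝ K
  let Λre : C(K, ℝ) →ₚ[ℝ] ℝ := PositiveLinearMap.mk₀
    (Complex.reLm ∘ₗ Λ.toLinearMap.restrictScalars ℝ ∘ₗ ofReal.toLinearMap) fun f hf =>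
      (Complex.le_def.mp (map_nonneg Λ (a := ofReal f) fun x =>
        Complex.zero_le_real.mpr (hf x))).1
  obtain ⟨μ, hμ, h⟩ := exists_integral_real_eq Λre
  have hofReal (g : C(K, ℝ)) : ∫ x, ofReal g x ∂μ = Λ (ofReal g) := by
    have hsa : IsSelfAdjoint (Λ (ofReal g)) := by
      have hg : IsSelfAdjoint (ofReal g) := ContinuousMap.ext fun x => Complex.conj_ofReal _
      exact hg.map Λ
    rw [← Complex.conj_eq_iff_re.mp hsa]
    exact integral_complex_ofReal.trans (congrArg _ (h g))
  have hint (g : C(K, ℝ)) : Integrable (ofReal g) μ := (Linf.ofContinuous (ofReal g)).integrable μ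
  refine ⟨μ, hμ, fun f => ?_⟩
  let p : C(K, ℝ) := ⟨fun x => (f x).re, by fun_prop⟩
  let q : C(K, ℝ) := ⟨fun x => (f x).im, by fun_prop⟩
  have hf : f = ofReal p + Complex.I • ofReal q := ContinuousMap.ext fun x =>
    (Complex.re_add_im (f x)).symm.trans (by rw [mul_comm]; rfl)
  rw [hf, map_add, map_smul, ← hofReal, ← hofReal, smul_eq_mul, ← integral_const_mul,
    ← integral_add (hint p) ((hint q).const_mul _)]
  rfl

end Baire

/-! ### The Baire functional calculus -/

section IntegralFunctional

variable {X : Type*} [MeasurableSpace X]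

/-- The integral of bounded measurable functions against a finite measure, as a positive linear
functional. -/
def Linf.integral (μ : Measure X) [IsFiniteMeasure μ] : Linf X →ₚ[ℂ] ℂ :=
  PositiveLinearMap.mk₀
    { toFun := fun f => ∫ x, f x ∂μ
      map_add' := fun f g => integral_add (f.integrable μ) (g.integrable μ)
      map_smul' := fun c f => integral_const_mul c f }
    fun _ hf => integral_nonneg hf

theorem Linf.tendsto_integral_mul {a : ℕ → Linf X} {s : Linf X} (h : IncreasesTo a s) (g : Linf X)
    (μ : Measure X) [IsFiniteMeasure μ] :
    Tendsto (fun n => Linf.integral μ (a n * g)) atTop (𝓝 (Linf.integral μ (s * g))) :=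
  tendsto_integral_of_dominated_convergence (fun _ => (‖a 0‖ + ‖s‖) * ‖g‖)
    (fun n => (a n * g).measurable.aestronglyMeasurable) (integrable_const _)
    (fun n => ae_of_all _ fun x => by
      rw [Linf.mul_apply, norm_mul]
      gcongr
      · exact ((a n).norm_apply_le x).trans (Linf.norm_le_of_increasesTo h n)
      · exact g.norm_apply_le x)
    (ae_of_all _ fun x => (Linf.tendsto_of_increasesTo h x).mul_const (g x))

theorem Linf.tendsto_integral {a : ℕ → Linf X} {s : Linf X} (h : IncreasesTo a s)
    (μ : Measure X) [IsFiniteMeasure μ] :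
    Tendsto (fun n => Linf.integral μ (a n)) atTop (𝓝 (Linf.integral μ s)) := by
  simpa using Linf.tendsto_integral_mul h 1 μ

end IntegralFunctional

section WeakIntegral

open scoped InnerProductSpace

variable {H : Type*} [NormedAddCommGroup H] [InnerProductSpace ℂ H]

/-- The vector functional `T ↦ ⟪ξ, T ξ⟫`. -/
def vectorFunctional (ξ : H) : (H →L[ℂ] H) →ₚ[ℂ] ℂ where
  toFun T := ⟪ξ, T ξ⟫_ℂ
  map_add' _ _ := inner_add_right _ _ _
  map_smul' _ _ := inner_smul_right _ _ _
  monotone' _ _ h := operator_le_iff.mp h ξ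

variable {X : Type*} [MeasurableSpace X] (μ : H → Measure X) [∀ ξ, IsFiniteMeasure (μ ξ)]

/-- The functions `f` for which the numbers `∫ f dμ_ξ` are the values at `ξ` of the quadratic form
of a bounded operator, the weak integral of `f`. -/
def weaklyIntegrable : Submodule ℂ (Linf X) where
  carrier := {f | ∃ T : H →L[ℂ] H, ∀ ξ, vectorFunctional ξ T = Linf.integral (μ ξ) f}
  add_mem' := by
    rintro f g ⟨S, hS⟩ ⟨T, hT⟩
    exact ⟨S + T, fun ξ => by rw [map_add, map_add, hS, hT]⟩
  zero_mem' := ⟨0, fun ξ => by rw [map_zero, map_zero]⟩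
  smul_mem' := by
    rintro c f ⟨T, hT⟩
    exact ⟨c • T, fun ξ => by rw [map_smul, map_smul, hT]⟩

variable {μ}

theorem isSigmaClosed_weaklyIntegrable [CompleteSpace H] (hone : 1 ∈ weaklyIntegrable μ) :
    IsSigmaClosed (weaklyIntegrable μ) := by
  intro a s ha h
  choose T hT using ha
  obtain ⟨E, hE⟩ := hone
  have hmono : Monotone T := fun i j hij => operator_le_iff.mpr fun ξ =>
    (hT i ξ).trans_le ((OrderHomClass.mono _ (h.monotone hij)).trans_eq (hT j ξ).symm)
  have hs : IsSelfAdjoint s := (h.isSelfAdjoint 0).of_ge (h.isLUB.1 ⟨0, rfl⟩)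
  have hle (n : ℕ) : T n ≤ (‖s‖ : ℂ) • E := by
    refine operator_le_iff.mpr fun ξ => ?_
    have has : a n ≤ (‖s‖ : ℂ) • 1 := by
      refine (h.isLUB.1 ⟨n, rfl⟩).trans (hs.le_algebraMap_norm_self.trans_eq ?_)
      rw [Algebra.algebraMap_eq_smul_one, Complex.coe_smul]
    calc vectorFunctional ξ (T n) = Linf.integral (μ ξ) (a n) := hT n ξ
      _ ≤ Linf.integral (μ ξ) ((‖s‖ : ℂ) • 1) := OrderHomClass.mono _ has
      _ = vectorFunctional ξ ((‖s‖ : ℂ) • E) := by rw [map_smul, map_smul, hE]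
  obtain ⟨t, ht⟩ := exists_tendsto_operator_apply hmono fun n =>
    norm_le_of_mem_Icc ⟨hmono n.zero_le, hle n⟩
  refine ⟨t, fun ξ => tendsto_nhds_unique (tendsto_const_nhds.inner (ht ξ)) ?_⟩
  exact (Linf.tendsto_integral h (μ ξ)).congr fun n => (hT n ξ).symm

end WeakIntegral

section BaireCalculus

variable {K : Type*} [TopologicalSpace K] [MeasurableSpace K] [BaireMeasurable K] [CompactSpace K]
  [T2Space K] {H : Type*} [NormedAddCommGroup H] [InnerProductSpace ℂ H] [CompleteSpace H]
  (σ : C(K, ℂ) →⋆ₐ[ℂ] (H →L[ℂ] H))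

theorem exists_spectralMeasure (ξ : H) : ∃ μ : Measure K, IsFiniteMeasure μ ∧
    ∀ f : C(K, ℂ), ∫ x, f x ∂μ = vectorFunctional ξ (σ f) :=
  BaireMeasurable.exists_integral_eq ((vectorFunctional ξ).comp (PositiveLinearMap.ofClass σ))

/-- The Baire measure on `K` representing the functional `f ↦ ⟪ξ, σ f ξ⟫`. -/
def spectralMeasure (ξ : H) : Measure K := (exists_spectralMeasure σ ξ).choose

instance (ξ : H) : IsFiniteMeasure (spectralMeasure σ ξ) :=
  (exists_spectralMeasure σ ξ).choose_spec.1

theorem integral_spectralMeasure (ξ : H) (f : C(K, ℂ)) :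
    Linf.integral (spectralMeasure σ ξ) (Linf.ofContinuous f) = vectorFunctional ξ (σ f) :=
  (exists_spectralMeasure σ ξ).choose_spec.2 f

theorem mem_weaklyIntegrable_spectralMeasure (f : Linf K) :
    f ∈ weaklyIntegrable (spectralMeasure σ) := by
  have hcont (f : C(K, ℂ)) : Linf.ofContinuous f ∈ weaklyIntegrable (spectralMeasure σ) :=
    ⟨σ f, fun ξ => (integral_spectralMeasure σ ξ f).symm⟩
  exact Linf.mem_of_forall_ofContinuous_mem
    (isSigmaClosed_weaklyIntegrable (map_one (Linf.ofContinuous (K := K)) ▸ hcont 1)) hcont f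

theorem exists_linearMap_vectorFunctional_eq : ∃ T : Linf K →ₗ[ℂ] (H →L[ℂ] H),
    ∀ f ξ, vectorFunctional ξ (T f) = Linf.integral (spectralMeasure σ ξ) f := by
  choose T hT using mem_weaklyIntegrable_spectralMeasure σ
  refine ⟨⟨⟨T, fun f g => ?_⟩, fun c f => ?_⟩, hT⟩
  all_goals
    refine operator_ext fun ξ => ?_
    change vectorFunctional ξ _ = vectorFunctional ξ _
  · rw [hT, map_add, map_add, hT, hT]
  · rw [hT, map_smul, RingHom.id_apply, map_smul, hT]

/-- The linear map underlying the Baire functional calculus: `f` is sent to its weak integral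
against the spectral measures. -/
def baireCalculusLinear : Linf K →ₗ[ℂ] (H →L[ℂ] H) :=
  (exists_linearMap_vectorFunctional_eq σ).choose

theorem vectorFunctional_baireCalculusLinear (f : Linf K) (ξ : H) :
    vectorFunctional ξ (baireCalculusLinear σ f) = Linf.integral (spectralMeasure σ ξ) f :=
  (exists_linearMap_vectorFunctional_eq σ).choose_spec f ξ

theorem baireCalculusLinear_ofContinuous (f : C(K, ℂ)) :
    baireCalculusLinear σ (Linf.ofContinuous f) = σ f :=
  operator_ext fun ξ => (vectorFunctional_baireCalculusLinear σ _ ξ).trans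
    (integral_spectralMeasure σ ξ f)

theorem baireCalculusLinear_star (f : Linf K) :
    baireCalculusLinear σ (star f) = star (baireCalculusLinear σ f) :=
  operator_ext fun ξ => by
    change vectorFunctional ξ _ = vectorFunctional ξ _
    rw [map_star (vectorFunctional ξ), vectorFunctional_baireCalculusLinear,
      vectorFunctional_baireCalculusLinear, map_star]

theorem baireCalculusLinear_mono : Monotone (baireCalculusLinear σ) := fun f g h =>
  operator_le_iff.mpr fun ξ => by
    change vectorFunctional ξ _ ≤ vectorFunctional ξ _
    rw [vectorFunctional_baireCalculusLinear, vectorFunctional_baireCalculusLinear]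
    exact OrderHomClass.mono _ h

theorem increasesTo_baireCalculusLinear {a : ℕ → Linf K} {s : Linf K} (h : IncreasesTo a s) :
    IncreasesTo (fun n => baireCalculusLinear σ (a n)) (baireCalculusLinear σ s) := by
  refine increasesTo_of_tendsto_inner (fun n => ?_)
    ((baireCalculusLinear_mono σ).comp h.monotone) fun ξ => ?_
  · rw [isSelfAdjoint_iff, ← baireCalculusLinear_star, (h.isSelfAdjoint n).star_eq]
  · change Tendsto (fun n => vectorFunctional ξ (baireCalculusLinear σ (a n))) atTop
      (𝓝 (vectorFunctional ξ (baireCalculusLinear σ s)))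
    simp_rw [vectorFunctional_baireCalculusLinear]
    exact Linf.tendsto_integral h _

theorem baireCalculusLinear_mul_of_forall_ofContinuous {g : Linf K}
    (hg : ∀ f : C(K, ℂ), baireCalculusLinear σ (Linf.ofContinuous f * g) =
      baireCalculusLinear σ (Linf.ofContinuous f) * baireCalculusLinear σ g) (f : Linf K) :
    baireCalculusLinear σ (f * g) = baireCalculusLinear σ f * baireCalculusLinear σ g := by
  let V : Submodule ℂ (Linf K) := LinearMap.eqLocus
    (baireCalculusLinear σ ∘ₗ LinearMap.mulRight ℂ g)
    (LinearMap.mulRight ℂ (baireCalculusLinear σ g) ∘ₗ baireCalculusLinear σ)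
  suffices hV : IsSigmaClosed V from Linf.mem_of_forall_ofContinuous_mem hV hg f
  intro a s ha h
  replace ha (n : ℕ) : baireCalculusLinear σ (a n * g) =
    baireCalculusLinear σ (a n) * baireCalculusLinear σ g := ha n
  refine operator_ext fun ξ => ?_
  have hleft : Tendsto (fun n => vectorFunctional ξ (baireCalculusLinear σ (a n * g))) atTop
      (𝓝 (vectorFunctional ξ (baireCalculusLinear σ (s * g)))) := by
    simp_rw [vectorFunctional_baireCalculusLinear]
    exact Linf.tendsto_integral_mul h g _
  simp_rw [ha] at hleft
  exact tendsto_nhds_unique hleft (tendsto_const_nhds.inner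
    ((increasesTo_baireCalculusLinear σ h).tendsto_apply (baireCalculusLinear σ g ξ)))

theorem baireCalculusLinear_mul (f g : Linf K) :
    baireCalculusLinear σ (f * g) = baireCalculusLinear σ f * baireCalculusLinear σ g := by
  have hright (g : C(K, ℂ)) (f : Linf K) : baireCalculusLinear σ (f * Linf.ofContinuous g) =
      baireCalculusLinear σ f * baireCalculusLinear σ (Linf.ofContinuous g) := by
    refine baireCalculusLinear_mul_of_forall_ofContinuous σ (fun f => ?_) f
    simp only [← map_mul, baireCalculusLinear_ofContinuous]
  refine baireCalculusLinear_mul_of_forall_ofContinuous σ (fun f => star_injective ?_) f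
  rw [← baireCalculusLinear_star, star_mul, star_mul, ← map_star Linf.ofContinuous, hright,
    baireCalculusLinear_star, map_star, baireCalculusLinear_star]

/-- The Baire functional calculus: the extension of a representation of `C(K, ℂ)` to the bounded
Baire functions by integration against the spectral measures. -/
def baireCalculus : Linf K →⋆ₐ[ℂ] (H →L[ℂ] H) where
  __ := AlgHom.ofLinearMap (baireCalculusLinear σ)
    (by rw [← map_one Linf.ofContinuous, baireCalculusLinear_ofContinuous, map_one])
    (baireCalculusLinear_mul σ)
  map_star' := baireCalculusLinear_star σ

theorem baireCalculus_ofContinuous (f : C(K, ℂ)) :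
    baireCalculus σ (Linf.ofContinuous f) = σ f :=
  baireCalculusLinear_ofContinuous σ f

theorem increasesTo_baireCalculus {a : ℕ → Linf K} {s : Linf K} (h : IncreasesTo a s) :
    IncreasesTo (fun n => baireCalculus σ (a n)) (baireCalculus σ s) :=
  increasesTo_baireCalculusLinear σ h

theorem range_baireCalculus_subset :
    Set.range (baireCalculus σ) ⊆ sigmaClosure (Set.range σ) := by
  rintro _ ⟨f, rfl⟩ V hσV _ hV
  refine Linf.mem_of_forall_ofContinuous_mem (V := V.comap (baireCalculusLinear σ))
    (fun a s ha h => hV _ _ ha (increasesTo_baireCalculus σ h)) (fun f => ?_) f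
  rw [Submodule.mem_comap, baireCalculusLinear_ofContinuous]
  exact hσV ⟨f, rfl⟩

variable {σ} {v : K → H} (hv : ∀ x (f : C(K, ℂ)), vectorFunctional (v x) (σ f) = f x)

include hv

theorem vectorFunctional_baireCalculus (f : Linf K) (x : K) :
    vectorFunctional (v x) (baireCalculus σ f) = f x := by
  let V : Submodule ℂ (Linf K) := LinearMap.eqLocus
    ((vectorFunctional (v x)).toLinearMap ∘ₗ baireCalculusLinear σ)
    (Linf.eval x : Linf K →ₐ[ℂ] ℂ).toLinearMap
  refine Linf.mem_of_forall_ofContinuous_mem (V := V) (fun a s ha h => ?_) (fun f => ?_) f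
  · exact tendsto_nhds_unique (tendsto_const_nhds.inner
      ((increasesTo_baireCalculus σ h).tendsto_apply (v x)))
      ((Linf.tendsto_of_increasesTo h x).congr fun n => (ha n).symm)
  · exact (congrArg _ (baireCalculus_ofContinuous σ f)).trans (hv x f)

theorem baireCalculus_injective : Function.Injective (baireCalculus σ) := fun f g h =>
  Linf.ext fun x => by
    rw [← vectorFunctional_baireCalculus hv f x, ← vectorFunctional_baireCalculus hv g x, h]

theorem range_baireCalculus : Set.range (baireCalculus σ) = sigmaClosure (Set.range σ) := by
  refine (range_baireCalculus_subset σ).antisymm fun b hb =>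
    hb (baireCalculus σ : Linf K →ₐ[ℂ] (H →L[ℂ] H)).toLinearMap.range ?_ ?_ ?_
  · rintro _ ⟨f, rfl⟩
    exact ⟨Linf.ofContinuous f, baireCalculus_ofContinuous σ f⟩
  · rintro _ ⟨f, rfl⟩
    exact ⟨star f, map_star (baireCalculus σ) f⟩
  · exact isSigmaClosed_range Linf.isSigmaComplete (baireCalculus_injective hv)
      fun _ _ h => (increasesTo_baireCalculus σ h).isLUB

end BaireCalculus

/-! ### Standard Borel spaces and compact metrizable spaces -/

section CompactMetrizable

open TopologicalSpace

theorem exists_homeomorph_of_measurableEquiv {X K : Type*} [MeasurableSpace X] [TopologicalSpace K]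
    [MeasurableSpace K] [BaireMeasurable K] (e : X ≃ᵐ K) :
    ∃ _ : TopologicalSpace X, BaireMeasurable X ∧ Nonempty (X ≃ₜ K) := by
  let : TopologicalSpace X := .induced e inferInstance
  let g : X ≃ₜ K := e.toEquiv.toHomeomorphOfIsInducing ⟨rfl⟩
  have hsurj : Function.Surjective fun f : C(K, ℝ) => f.comp (g : C(X, K)) := fun f =>
    ⟨f.comp (g.symm : C(K, X)), ContinuousMap.ext fun x => congrArg f (g.symm_apply_apply x)⟩
  refine ⟨_, ⟨?_⟩, ⟨g⟩⟩
  calc _ = MeasurableSpace.comap e (⨆ f : C(K, ℝ), (borel ℝ).comap f) :=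
        e.measurableEmbedding.comap_eq.symm.trans
          (congrArg (MeasurableSpace.comap (e : X → K)) BaireMeasurable.eq_iSup)
    _ = ⨆ f : C(K, ℝ), ((borel ℝ).comap f).comap e := MeasurableSpace.comap_iSup
    _ = _ := hsurj.iSup_congr _ fun f => (MeasurableSpace.comap_comp (f := f) (g := e)).symm

theorem metrizableSpace_of_separableSpace_continuousMap (K : Type*) [TopologicalSpace K]
    [CompactSpace K] [T2Space K] [SeparableSpace C(K, ℂ)] : MetrizableSpace K := by
  refine Metric.PiNatEmbed.TopologicalSpace.MetrizableSpace.of_countable_separating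
    (fun n => denseSeq C(K, ℂ) n) (fun n => map_continuous _) ?_
  intro x y hne
  by_contra! h
  have heval : (fun f : C(K, ℂ) => f x) = fun f => f y :=
    (denseRange_denseSeq C(K, ℂ)).equalizer (continuous_eval_const x) (continuous_eval_const y)
      (funext h)
  exact hne ((WeakDual.CharacterSpace.continuousMapEval_bijective (X := K) (𝕜 := ℂ)).1
    (Subtype.ext (DFunLike.ext _ _ (congrFun heval))))

theorem borelSpace_of_countable (K : Type*) [Countable K] [TopologicalSpace K] [T1Space K]
    [MeasurableSpace K] [DiscreteMeasurableSpace K] : BorelSpace K :=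
  ⟨MeasurableSpace.ext fun s => ⟨fun _ => by
    let : MeasurableSpace K := borel K
    have : BorelSpace K := ⟨rfl⟩
    exact s.to_countable.measurableSet, fun _ => .of_discrete⟩⟩

theorem exists_compact_metrizable_measurableEquiv (X : Type*) [MeasurableSpace X]
    [StandardBorelSpace X] :
    ∃ (K : Type) (_ : TopologicalSpace K) (_ : MeasurableSpace K),
      CompactSpace K ∧ MetrizableSpace K ∧ BorelSpace K ∧ Nonempty (X ≃ᵐ K) := by
  by_cases hc : Countable X
  · rcases finite_or_infinite X with hfin | hinf
    · obtain ⟨n, ⟨e⟩⟩ := Finite.exists_equiv_fin X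
      exact ⟨Fin n, _, _, inferInstance, inferInstance, borelSpace_of_countable _,
        ⟨PolishSpace.Equiv.measurableEquiv e⟩⟩
    · obtain ⟨e⟩ := nonempty_equiv_of_countable (α := X) (β := ℕ∞)
      exact ⟨ℕ∞, _, _, inferInstance, inferInstance, borelSpace_of_countable _,
        ⟨PolishSpace.Equiv.measurableEquiv e⟩⟩
  · exact ⟨ℕ → Bool, _, _, inferInstance, inferInstance, inferInstance,
      ⟨PolishSpace.measurableEquivNatBoolOfNotCountable hc⟩⟩

end CompactMetrizable

/-! ### Pedersen–Baire envelopes -/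

section Spectrum

namespace SigmaSpectrum

variable {A B : Type*} [CStarAlgebra A] [PartialOrder A] [StarOrderedRing A] [CStarAlgebra B]
  [PartialOrder B] [StarOrderedRing B]

/-- The isomorphism of Gelfand σ-spectra induced by an isomorphism of algebras. -/
def comapEquiv (e : A ≃⋆ₐ[ℂ] B) : SigmaSpectrum B ≃ᵐ SigmaSpectrum A where
  toFun := comap e
  invFun := comap e.symm
  left_inv χ := ext fun b => congrArg χ.1 (e.apply_symm_apply b)
  right_inv χ := ext fun a => congrArg χ.1 (e.symm_apply_apply a)
  measurable_toFun := measurable_of_forall fun a => measurable_apply (e a)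
  measurable_invFun := measurable_of_forall fun b => measurable_apply (e.symm b)

end SigmaSpectrum

namespace Linf

variable {K : Type*} [TopologicalSpace K] [MeasurableSpace K] [BaireMeasurable K] [CompactSpace K]

/-- The restriction of a point of the Gelfand σ-spectrum to the continuous functions. -/
def restrictCharacter (χ : SigmaSpectrum (Linf K)) : WeakDual.characterSpace ℂ C(K, ℂ) :=
  WeakDual.CharacterSpace.equivAlgHom.symm (χ.1.comp ofContinuous : C(K, ℂ) →ₐ[ℂ] ℂ)

theorem restrictCharacter_injective : Function.Injective (restrictCharacter (K := K)) := by
  intro χ ψ h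
  refine SigmaSpectrum.ext fun a => mem_of_forall_ofContinuous_mem
    (isSigmaClosed_eqLocus (φ := (χ.1 : Linf K →ₐ[ℂ] ℂ).toLinearMap)
      (ψ := (ψ.1 : Linf K →ₐ[ℂ] ℂ).toLinearMap) χ.2 ψ.2) (fun f => ?_) a
  exact DFunLike.congr_fun h f

theorem evalSpec_bijective [T2Space K] : Function.Bijective (evalSpec (X := K)) := by
  have h : Function.Bijective (restrictCharacter ∘ evalSpec (X := K)) :=
    WeakDual.CharacterSpace.continuousMapEval_bijective (X := K) (𝕜 := ℂ)
  exact ⟨h.1.of_comp, h.2.of_comp_left restrictCharacter_injective⟩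

theorem measurable_of_measurable_evalSpec_comp {Y : Type*} [MeasurableSpace Y] {g : Y → K}
    (hg : Measurable (evalSpec ∘ g)) : Measurable g := by
  refine BaireMeasurable.measurable_of_forall fun f => ?_
  let fc : C(K, ℂ) := ⟨fun x => (f x : ℂ), by fun_prop⟩
  exact Complex.measurable_re.comp ((SigmaSpectrum.measurable_apply (ofContinuous fc)).comp hg)

/-- The identification of a compact Hausdorff space with the Gelfand σ-spectrum of its algebra of
bounded Baire functions. -/
def evalSpecEquiv [T2Space K] : K ≃ᵐ SigmaSpectrum (Linf K) where
  toEquiv := .ofBijective _ evalSpec_bijective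
  measurable_toFun := SigmaSpectrum.measurable_of_forall measurable
  measurable_invFun := measurable_of_measurable_evalSpec_comp <| by
    have hid : evalSpec ∘ (Equiv.ofBijective _ (evalSpec_bijective (K := K))).symm = id :=
      funext (Equiv.ofBijective_apply_symm_apply _ evalSpec_bijective)
    exact hid ▸ measurable_id

end Linf

end Spectrum

section Envelope

variable {A : Type*} [CStarAlgebra A] [PartialOrder A] [StarOrderedRing A]

theorem isPedersenBaireEnvelope_linf {K : Type*} [TopologicalSpace K] [MeasurableSpace K]
    [BaireMeasurable K] [CompactSpace K] [T2Space K] (ρ : A ≃⋆ₐ[ℂ] C(K, ℂ)) :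
    IsPedersenBaireEnvelope A (Linf K) := by
  let σ : C(K, ℂ) →⋆ₐ[ℂ] (UnivHilbert A →L[ℂ] UnivHilbert A) :=
    (universalRep A).comp (ρ.symm : C(K, ℂ) →⋆ₐ[ℂ] A)
  have hvector (x : K) : ∃ v, ∀ f : C(K, ℂ), vectorFunctional v (σ f) = f x := by
    let φ : A →ₚ[ℂ] ℂ := PositiveLinearMap.mk₀
      (((ContinuousMap.evalStarAlgHom ℂ ℂ x).comp (ρ : A →⋆ₐ[ℂ] C(K, ℂ)) : A →ₐ[ℂ] ℂ).toLinearMap)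
      fun a ha => (map_nonneg (ρ : A →⋆ₐ[ℂ] C(K, ℂ)) ha : 0 ≤ ρ a) x
    have hφ (a : A) : φ a = ρ a x := rfl
    obtain ⟨v, hv⟩ := exists_inner_universalRep φ (congrArg (· x) (map_one ρ))
    refine ⟨v, fun f => (hv (ρ.symm f)).trans ?_⟩
    rw [hφ, StarAlgEquiv.apply_symm_apply]
  choose v hv using hvector
  refine ⟨baireCalculus σ, baireCalculus_injective hv, (range_baireCalculus hv).trans ?_⟩
  exact congrArg sigmaClosure (ρ.symm.surjective.range_comp (universalRep A))

theorem nonempty_equiv_of_range_eq {B C D : Type*} [CStarAlgebra B] [CStarAlgebra C]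
    [CStarAlgebra D] {φ : B →⋆ₐ[ℂ] D} {ψ : C →⋆ₐ[ℂ] D} (hφ : Function.Injective φ)
    (hψ : Function.Injective ψ) (hr : Set.range φ = Set.range ψ) : Nonempty (B ≃⋆ₐ[ℂ] C) := by
  have h : φ.range = ψ.range := SetLike.coe_injective hr
  have e : Nonempty (B ≃⋆ₐ[ℂ] ψ.range) := h ▸ ⟨StarAlgEquiv.ofInjective φ hφ⟩
  exact e.map fun e => e.trans (StarAlgEquiv.ofInjective ψ hψ).symm

theorem IsPedersenBaireEnvelope.nonempty_equiv {B C : Type*} [CStarAlgebra B] [CStarAlgebra C]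
    (hB : IsPedersenBaireEnvelope A B) (hC : IsPedersenBaireEnvelope A C) :
    Nonempty (B ≃⋆ₐ[ℂ] C) := by
  obtain ⟨ι, hι, hr⟩ := hB
  obtain ⟨κ, hκ, hs⟩ := hC
  exact nonempty_equiv_of_range_eq
    (D := UnivHilbert A →L[ℂ] UnivHilbert A) (φ := ι) (ψ := κ) hι hκ (hr.trans hs.symm)

theorem IsPedersenBaireEnvelope.mul_comm {B : Type*} [CommCStarAlgebra B]
    (h : IsPedersenBaireEnvelope A B) (a b : A) : a * b = b * a := by
  obtain ⟨ι, -, hr⟩ := h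
  have hmem (a : A) : universalRep A a ∈ Set.range ι := hr.ge fun _ hV _ _ => hV ⟨a, rfl⟩
  obtain ⟨a', ha⟩ := hmem a
  obtain ⟨b', hb⟩ := hmem b
  refine universalRep_injective ?_
  rw [map_mul, map_mul, ← ha, ← hb, ← map_mul, ← map_mul, _root_.mul_comm]

theorem exists_equiv_continuousMap (A : Type u) [CStarAlgebra A]
    (hcomm : ∀ a b : A, a * b = b * a) :
    ∃ (K : Type u) (_ : TopologicalSpace K) (_ : CompactSpace K) (_ : T2Space K),
      Nonempty (A ≃⋆ₐ[ℂ] C(K, ℂ)) := by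
  let : CommCStarAlgebra A := { mul_comm := hcomm }
  exact ⟨WeakDual.characterSpace ℂ A, inferInstance, inferInstance, inferInstance,
    ⟨gelfandStarTransform A⟩⟩

theorem IsPedersenBaireEnvelope.exists_equiv_linf {A : Type u} [CStarAlgebra A] [PartialOrder A]
    [StarOrderedRing A] {B : Type*} [CommCStarAlgebra B] (h : IsPedersenBaireEnvelope A B) :
    ∃ (K : Type u) (_ : TopologicalSpace K) (_ : MeasurableSpace K) (_ : BaireMeasurable K)
      (_ : CompactSpace K) (_ : T2Space K), Nonempty (A ≃⋆ₐ[ℂ] C(K, ℂ)) ∧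
        Nonempty (B ≃⋆ₐ[ℂ] Linf K) := by
  obtain ⟨K, _, _, _, ⟨ρ⟩⟩ := exists_equiv_continuousMap A h.mul_comm
  let : MeasurableSpace K := ⨆ f : C(K, ℝ), (borel ℝ).comap f
  have : BaireMeasurable K := ⟨rfl⟩
  exact ⟨K, _, _, inferInstance, inferInstance, inferInstance, ⟨ρ⟩,
    h.nonempty_equiv (isPedersenBaireEnvelope_linf ρ)⟩

end Envelope

namespace CommSigmaCStar

theorem isPedBaireSep_le_isPedBaire : isPedBaireSep.{u} ≤ isPedBaire := by
  rintro B ⟨A, i₁, i₂, i₃, -, h⟩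
  exact ⟨A, i₁, i₂, i₃, h⟩

theorem isPedBaire_le_isPure : isPedBaire.{u} ≤ isPure := by
  rintro B ⟨A, _, _, _, h⟩
  obtain ⟨K, _, _, _, _, _, -, ⟨e⟩⟩ := h.exists_equiv_linf
  exact (Linf.isPurelySigmaRepresentable (X := K)).of_equiv e

theorem isBaire_specStoch {B : CommSigmaCStar.{u}} (hB : isPedBaire B) : isBaire (specStoch B) := by
  obtain ⟨A, _, _, _, h⟩ := hB
  obtain ⟨K, _, _, _, _, _, -, ⟨e⟩⟩ := h.exists_equiv_linf
  obtain ⟨_, hX, ⟨g⟩⟩ := exists_homeomorph_of_measurableEquiv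
    ((SigmaSpectrum.comapEquiv e).symm.trans Linf.evalSpecEquiv.symm)
  exact ⟨_, g.symm.compactSpace, g.symm.t2Space, hX.eq_iSup⟩

theorem isStandardBorel_specStoch {B : CommSigmaCStar.{u}} (hB : isPedBaireSep B) :
    isStandardBorel (specStoch B) := by
  obtain ⟨A, _, _, _, _, h⟩ := hB
  obtain ⟨K, _, _, _, _, _, ⟨ρ⟩, ⟨e⟩⟩ := h.exists_equiv_linf
  have hρ : Continuous ρ := map_continuous (ρ : A →⋆ₐ[ℂ] C(K, ℂ))
  have : TopologicalSpace.SeparableSpace C(K, ℂ) := ρ.surjective.denseRange.separableSpace hρ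
  have := metrizableSpace_of_separableSpace_continuousMap K
  let := TopologicalSpace.metrizableSpaceMetric K
  obtain ⟨_, hX, ⟨g⟩⟩ := exists_homeomorph_of_measurableEquiv
    ((SigmaSpectrum.comapEquiv e).symm.trans Linf.evalSpecEquiv.symm)
  have : PolishSpace (SigmaSpectrum B) := g.isClosedEmbedding.polishSpace
  have : BorelSpace (SigmaSpectrum B) := baireMeasurable_iff_borelSpace.mp hX
  change StandardBorelSpace (SigmaSpectrum B)
  infer_instance

theorem isPedBaire_koopman {X : Stoch.{u}} (hX : isBaire X) : isPedBaire (koopman.obj (.op X)) := by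
  obtain ⟨_, _, _, h⟩ := hX
  have : BaireMeasurable X.obj := ⟨h⟩
  exact ⟨C(X.obj, ℂ), _, _, inferInstance, isPedersenBaireEnvelope_linf (.refl ..)⟩

theorem isPedBaireSep_koopman {X : Stoch.{u}} (hX : isStandardBorel X) :
    isPedBaireSep (koopman.obj (.op X)) := by
  have : StandardBorelSpace X.obj := hX
  obtain ⟨K, _, _, _, _, _, ⟨e⟩⟩ := exists_compact_metrizable_measurableEquiv X.obj
  have : BaireMeasurable K := baireMeasurable_iff_borelSpace.mpr inferInstance
  obtain ⟨_, _, ⟨g⟩⟩ := exists_homeomorph_of_measurableEquiv e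
  have : CompactSpace X.obj := g.symm.compactSpace
  have : TopologicalSpace.MetrizableSpace X.obj := g.isEmbedding.metrizableSpace
  let := TopologicalSpace.metrizableSpaceMetric X.obj
  exact ⟨C(X.obj, ℂ), _, _, inferInstance, inferInstance,
    isPedersenBaireEnvelope_linf (.refl ..)⟩

end CommSigmaCStar

end

theorem proposition4p34 :
    (koopman.{u}.Full ∧ koopman.{u}.Faithful) ∧
    ∃ (hL : ∀ X : Stoch.{u}ᵒᵖ, CommSigmaCStar.isPure (koopman.obj X)) (S : SpecAction.{u}),
      (∃ e : Stoch.{u}ᵒᵖ ≌ CommSigmaCStar.isPure.{u}.FullSubcategory,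
        e.functor = CommSigmaCStar.isPure.lift koopman hL ∧ e.inverse = S.functor.rightOp) ∧
      RestrictsToDuality isBaire CommSigmaCStar.isPedBaire S ∧
      RestrictsToDuality isStandardBorel CommSigmaCStar.isPedBaireSep S :=
  ⟨⟨inferInstance, inferInstance⟩, isPure_koopman, specAction, exists_duality,
    restrictsToDuality _ _ CommSigmaCStar.isPedBaire_le_isPure
      (fun _ => CommSigmaCStar.isPedBaire_koopman) fun _ => CommSigmaCStar.isBaire_specStoch,
    restrictsToDuality _ _
      (CommSigmaCStar.isPedBaireSep_le_isPedBaire.trans CommSigmaCStar.isPedBaire_le_isPure)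
      (fun _ => CommSigmaCStar.isPedBaireSep_koopman)
      fun _ => CommSigmaCStar.isStandardBorel_specStoch⟩
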